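/- **Setting.** Let $n$ be the number of vehicles, and let $0<R_{in}<R_{out}$, $v_{\max}>0$, $\omega^*\in(0,v_{\max}/R_{out})$ and $\Theta\in(0,\pi/2)$ with $\cos\Theta>R_{out}\omega^*/v_{\max}$. Let $\sigma_i>0$, $p_{i,j}=p_{j,i}>0$ for $i,j=1,\dots,n$, $L_{i,j}=L_{j,i}>0$ for $i\ne j$, and let $\lambda>0$ satisfy $\lambda>L_{i,j}$ for all $i\neq j$. Let $A>0$ and $b>1/R_{in}^2$. For $w=(r,\varphi,s,v)\in\mathbb R^{4n}$ put $$d_{i,j}=\sqrt{p_{i,j}(r_i-r_j)^2+2r_ir_j(1-\cos(\varphi_i-\varphi_j))},$$ $$\Omega=\{w:\ r_i\in(R_{in},R_{out}),\ s_i\in(-\Theta,\Theta),\ v_i\in(0,v_{\max})\ \text{for all } i,\ \ d_{i,j}>L_{i,j}\ \text{for all } j\ne i\}.$$ For $i\ne j$ let $V_{i,j}=V_{j,i}:(L_{i,j},\infty)\to[0,\infty)$ be $C^2$ with $V_{i,j}(d)\to+\infty$ as $d\to L_{i,j}^+$ and $V_{i,j}(d)=0$ for $d\ge\lambda$; let $\kappa_{i,j}=\kappa_{j,i}:(L_{i,j},\infty)\to[0,\infty)$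 be $C^1$ with $\kappa_{i,j}(d)=0$ for $d\ge\lambda$; let $U_i:(R_{in},R_{out})\to[0,\infty)$ be $C^2$ with $U_i(r)\to+\infty$ as $r\to R_{in}^+$ and as $r\to R_{out}^-$. Let $g_1,g_2:\mathbb R\to\mathbb R$ be $C^1$ and non-decreasing, and let $f_1,f_2:\mathbb R\to\mathbb R$ be $C^1$ with $f_k(0)=0$ and $xf_k(x)>0$ for $x\neq0$. For $w\in\Omega$ define $$\begin{aligned}H_R(w)={}&\frac12\sum_i\frac{\left(\frac{v_i}{r_i}\cos s_i-\omega^*\right)^2+bv_i^2\sin^2 s_i}{(v_{\max}-v_i)v_i}+\sum_iU_i(r_i)+\frac12\sum_i\sum_{j\ne i}V_{i,j}(d_{i,j})\\&+A\sum_i\left(\frac1{\cos s_i-\cos\Theta}-\frac1{1-\cos\Theta}\right),\end{aligned}$$ $$\Phi_i(w)=\frac{r_i}{\omega^*}\sum_{j\ne i}V_{i,j}'(d_{i,j})\frac{r_j\sin(\varphi_i-\varphi_j)}{d_{i,j}},\qquad G_i(w)=\frac1{\omega^*}\sum_{j\ne i}\kappa_{i,j}(d_{i,j})\left(g_1\!\left(\tfrac{v_j}{r_j}\cos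 s_j\right)-g_1\!\left(\tfrac{v_i}{r_i}\cos s_i\right)\right),$$ $$M_i(w)=\sum_{j\ne i}\kappa_{i,j}(d_{i,j})\left(g_2(\sin s_j)-g_2(\sin s_i)\right),\qquad q(r,s,v)=\frac{v_{\max}v\cos s-2rv\omega^*+r\omega^*v_{\max}}{2r(v_{\max}-v)^2v^2},$$ $$\gamma(r,s,v)=\frac{A}{(\cos s-\cos\Theta)^2}+\frac{v\cos s}{v_{\max}-v}\left(b-\frac1{r^2}\right)+\frac{\omega^*}{r(v_{\max}-v)},\qquad \zeta(s,v)=\frac{bv_{\max}\sin s}{2(v_{\max}-v)^2v},$$ $$Z_i(w)=\left(\frac{v_i}{r_i}\cos s_i-\omega^*\right)\frac{\cos s_i}{(v_{\max}-v_i)r_i^2}-U_i'(r_i)-\sum_{j\ne i}\left(p_{i,j}(r_i-r_j)+r_j(1-\cos(\varphi_i-\varphi_j))\right)\frac{V_{i,j}'(d_{i,j})}{d_{i,j}}.$$ The Pseudo-Relativistic Cruise Controller is the feedback $$F_i=-\frac1{q(r_i,s_i,v_i)}\left(f_1\!\left(\tfrac{v_i}{r_i}\cos s_i-\omega^*\right)+\omega^*(\Phi_i(w)-G_i(w))\right),$$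 $$\delta_i=\arctan\!\left(\frac{\sigma_i}{r_i}\cos s_i-\frac{\sigma_i}{\gamma(r_i,s_i,v_i)v_i}\Big(f_2(\sin s_i)+\big(\zeta(s_i,v_i)F_i+Z_i(w)\big)v_i-M_i(w)\Big)\right),$$ and the closed-loop system is, for $i=1,\dots,n$, $$\dot r_i=-v_i\sin s_i,\quad \dot\varphi_i=\frac{v_i}{r_i}\cos s_i,\quad \dot s_i=\frac{v_i}{\sigma_i}\tan\delta_i-\frac{v_i}{r_i}\cos s_i,\quad \dot v_i=F_i.$$ **Theorem.** For every $w_0\in\Omega$ the closed-loop system with $w(0)=w_0$ has a unique solution $w(t)$; it is defined for all $t\ge0$, satisfies $w(t)\in\Omega$ for all $t\ge0$, and for every $i=1,\dots,n$, as $t\to+\infty$, $$s_i(t)\to0,\qquad \frac{v_i(t)}{r_i(t)}\to\omega^*,\qquad \dot s_i(t)\to0,\qquad F_i(t)\to0.$$ Furthermore $H_R\ge 0$ on $\Omega$, and there is a non-decreasing function $P_2:[0,\infty)\to[0,\infty)$, independent of $w_0$, such that for every $w_0\in\Omega$ the corresponding solution satisfies $$|F_i(t)|+|\delta_i(t)|\le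 P_2(H_R(w_0))\qquad\text{for all }t\ge0,\ i=1,\dots,n.$$ -/

import Mathlib

open Set Filter Topology

noncomputable section

/-- The data of a ring-road with `n` vehicles together with the design parameters of the
pseudo-relativistic cruise controller. Functions that are only meaningful on an interval
(`V i j` and `κ i j` on `(L i j, ∞)`, `U i` on `(Rin, Rout)`) are total functions whose values
outside that interval are irrelevant, as are the entries `V i i`, `κ i i`, `L i i`. -/
structure RingRoad (n : ℕ) where
  /-- inner radius -/
  Rin : ℝ
  /-- outer radius -/
  Rout : ℝ
  /-- speed limit -/
  vmax : ℝ
  /-- angular speed set-point -/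
  ω : ℝ
  /-- maximal relative orientation -/
  Θ : ℝ
  /-- lengths of the vehicles -/
  σ : Fin n → ℝ
  /-- weights in the inter-vehicle distance -/
  p : Fin n → Fin n → ℝ
  /-- minimal inter-vehicle distances -/
  L : Fin n → Fin n → ℝ
  /-- interaction range -/
  lam : ℝ
  /-- vehicle-repulsive potentials -/
  V : Fin n → Fin n → ℝ → ℝ
  /-- boundary-repulsive potentials -/
  U : Fin n → ℝ → ℝ
  /-- viscosity coefficients -/
  κ : Fin n → Fin n → ℝ → ℝ
  /-- weight of the orientation penalty in the Lyapunov function -/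
  A : ℝ
  /-- weight of the radial kinetic energy in the Lyapunov function -/
  b : ℝ
  g₁ : ℝ → ℝ
  g₂ : ℝ → ℝ
  f₁ : ℝ → ℝ
  f₂ : ℝ → ℝ

/-- The states `w = (r, φ, s, v) ∈ ℝ⁴ⁿ`. -/
abbrev State (n : ℕ) : Type := (Fin n → ℝ) × (Fin n → ℝ) × (Fin n → ℝ) × (Fin n → ℝ)

namespace State

variable {n : ℕ}

/-- radial coordinates -/
def r (w : State n) : Fin n → ℝ := w.1
/-- angular coordinates -/
def φ (w : State n) : Fin n → ℝ := w.2.1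
/-- relative orientations -/
def s (w : State n) : Fin n → ℝ := w.2.2.1
/-- speeds -/
def v (w : State n) : Fin n → ℝ := w.2.2.2

end State

namespace RingRoad

variable {n : ℕ}

/-- The standing assumptions on the road, the vehicles and the design parameters. -/
structure IsAdmissible (P : RingRoad n) : Prop where
  Rin_pos : 0 < P.Rin
  Rin_lt_Rout : P.Rin < P.Rout
  vmax_pos : 0 < P.vmax
  ω_pos : 0 < P.ω
  ω_lt : P.ω < P.vmax / P.Rout
  Θ_pos : 0 < P.Θ
  Θ_lt : P.Θ < Real.pi / 2
  cos_Θ : P.Rout * P.ω / P.vmax < Real.cos P.Θ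
  σ_pos : ∀ i, 0 < P.σ i
  p_pos : ∀ i j, 0 < P.p i j
  p_symm : ∀ i j, P.p i j = P.p j i
  L_pos : ∀ i j, i ≠ j → 0 < P.L i j
  L_symm : ∀ i j, i ≠ j → P.L i j = P.L j i
  lam_pos : 0 < P.lam
  L_lt_lam : ∀ i j, i ≠ j → P.L i j < P.lam
  V_contDiffOn : ∀ i j, i ≠ j → ContDiffOn ℝ 2 (P.V i j) (Ioi (P.L i j))
  V_nonneg : ∀ i j, i ≠ j → ∀ d, P.L i j < d → 0 ≤ P.V i j d
  V_tendsto : ∀ i j, i ≠ j → Tendsto (P.V i j) (𝓝[>] (P.L i j)) atTop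
  V_eq_zero : ∀ i j, i ≠ j → ∀ d, P.lam ≤ d → P.V i j d = 0
  V_symm : ∀ i j, i ≠ j → ∀ d, P.L i j < d → P.V i j d = P.V j i d
  U_contDiffOn : ∀ i, ContDiffOn ℝ 2 (P.U i) (Ioo P.Rin P.Rout)
  U_nonneg : ∀ i, ∀ x ∈ Ioo P.Rin P.Rout, 0 ≤ P.U i x
  U_tendsto_Rin : ∀ i, Tendsto (P.U i) (𝓝[>] P.Rin) atTop
  U_tendsto_Rout : ∀ i, Tendsto (P.U i) (𝓝[<] P.Rout) atTop
  κ_contDiffOn : ∀ i j, i ≠ j → ContDiffOn ℝ 1 (P.κ i j) (Ioi (P.L i j))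
  κ_nonneg : ∀ i j, i ≠ j → ∀ d, P.L i j < d → 0 ≤ P.κ i j d
  κ_symm : ∀ i j, i ≠ j → ∀ d, P.L i j < d → P.κ i j d = P.κ j i d
  κ_eq_zero : ∀ i j, i ≠ j → ∀ d, P.lam ≤ d → P.κ i j d = 0
  A_pos : 0 < P.A
  b_gt : 1 / P.Rin ^ 2 < P.b
  g₁_contDiff : ContDiff ℝ 1 P.g₁
  g₁_mono : Monotone P.g₁
  g₂_contDiff : ContDiff ℝ 1 P.g₂
  g₂_mono : Monotone P.g₂
  f₁_contDiff : ContDiff ℝ 1 P.f₁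
  f₁_zero : P.f₁ 0 = 0
  f₁_sign : ∀ x, x ≠ 0 → 0 < x * P.f₁ x
  f₂_contDiff : ContDiff ℝ 1 P.f₂
  f₂_zero : P.f₂ 0 = 0
  f₂_sign : ∀ x, x ≠ 0 → 0 < x * P.f₂ x

/-- The weighted distance `d_{i,j}` between vehicles `i` and `j`. -/
def dist (P : RingRoad n) (w : State n) (i j : Fin n) : ℝ :=
  Real.sqrt (P.p i j * (w.r i - w.r j) ^ 2
    + 2 * w.r i * w.r j * (1 - Real.cos (w.φ i - w.φ j)))

/-- The state space `Ω`. -/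
def Ω (P : RingRoad n) : Set (State n) :=
  {w | (∀ i, w.r i ∈ Ioo P.Rin P.Rout) ∧ (∀ i, w.s i ∈ Ioo (-P.Θ) P.Θ) ∧
    (∀ i, w.v i ∈ Ioo 0 P.vmax) ∧ ∀ i j, j ≠ i → P.L i j < P.dist w i j}

/-- The Lyapunov function `H_R`. -/
def HR (P : RingRoad n) (w : State n) : ℝ :=
  (1 / 2) * ∑ i, ((w.v i / w.r i * Real.cos (w.s i) - P.ω) ^ 2
        + P.b * w.v i ^ 2 * Real.sin (w.s i) ^ 2) / ((P.vmax - w.v i) * w.v i)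
    + ∑ i, P.U i (w.r i)
    + (1 / 2) * ∑ i, ∑ j ∈ Finset.univ.erase i, P.V i j (P.dist w i j)
    + P.A * ∑ i, (1 / (Real.cos (w.s i) - Real.cos P.Θ) - 1 / (1 - Real.cos P.Θ))

/-- `Φ_i`; the derivative of `V i j` is taken at a point of its open domain when `w ∈ Ω`. -/
def Φ (P : RingRoad n) (w : State n) (i : Fin n) : ℝ :=
  w.r i / P.ω * ∑ j ∈ Finset.univ.erase i,
    deriv (P.V i j) (P.dist w i j) * (w.r j * Real.sin (w.φ i - w.φ j) / P.dist w i j)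

/-- `G_i` -/
def G (P : RingRoad n) (w : State n) (i : Fin n) : ℝ :=
  1 / P.ω * ∑ j ∈ Finset.univ.erase i, P.κ i j (P.dist w i j) *
    (P.g₁ (w.v j / w.r j * Real.cos (w.s j)) - P.g₁ (w.v i / w.r i * Real.cos (w.s i)))

/-- `M_i` -/
def M (P : RingRoad n) (w : State n) (i : Fin n) : ℝ :=
  ∑ j ∈ Finset.univ.erase i, P.κ i j (P.dist w i j) *
    (P.g₂ (Real.sin (w.s j)) - P.g₂ (Real.sin (w.s i)))

/-- `q(r, s, v)` -/
def q (P : RingRoad n) (r s v : ℝ) : ℝ :=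
  (P.vmax * v * Real.cos s - 2 * r * v * P.ω + r * P.ω * P.vmax)
    / (2 * r * (P.vmax - v) ^ 2 * v ^ 2)

/-- `γ(r, s, v)` -/
def γ (P : RingRoad n) (r s v : ℝ) : ℝ :=
  P.A / (Real.cos s - Real.cos P.Θ) ^ 2
    + v * Real.cos s / (P.vmax - v) * (P.b - 1 / r ^ 2)
    + P.ω / (r * (P.vmax - v))

/-- `ζ(s, v)` -/
def ζ (P : RingRoad n) (s v : ℝ) : ℝ :=
  P.b * P.vmax * Real.sin s / (2 * (P.vmax - v) ^ 2 * v)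

/-- `Z_i` -/
def Z (P : RingRoad n) (w : State n) (i : Fin n) : ℝ :=
  (w.v i / w.r i * Real.cos (w.s i) - P.ω) * (Real.cos (w.s i) / ((P.vmax - w.v i) * w.r i ^ 2))
    - deriv (P.U i) (w.r i)
    - ∑ j ∈ Finset.univ.erase i,
        (P.p i j * (w.r i - w.r j) + w.r j * (1 - Real.cos (w.φ i - w.φ j)))
          * (deriv (P.V i j) (P.dist w i j) / P.dist w i j)

/-- The acceleration `F_i` commanded by the pseudo-relativistic cruise controller. -/
def F (P : RingRoad n) (w : State n) (i : Fin n) : ℝ :=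
  -(1 / P.q (w.r i) (w.s i) (w.v i)) *
    (P.f₁ (w.v i / w.r i * Real.cos (w.s i) - P.ω) + P.ω * (P.Φ w i - P.G w i))

/-- The steering angle `δ_i` commanded by the pseudo-relativistic cruise controller. -/
def δ (P : RingRoad n) (w : State n) (i : Fin n) : ℝ :=
  Real.arctan (P.σ i / w.r i * Real.cos (w.s i)
    - P.σ i / (P.γ (w.r i) (w.s i) (w.v i) * w.v i) *
      (P.f₂ (Real.sin (w.s i))
        + (P.ζ (w.s i) (w.v i) * P.F w i + P.Z w i) * w.v i - P.M w i))

/-- The right-hand side of the bicycle model in polar coordinates, for inputs `F` and `δ`. -/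
def bicycle (P : RingRoad n) (w : State n) (F δ : Fin n → ℝ) : State n :=
  (fun i => -(w.v i) * Real.sin (w.s i),
   fun i => w.v i / w.r i * Real.cos (w.s i),
   fun i => w.v i / P.σ i * Real.tan (δ i) - w.v i / w.r i * Real.cos (w.s i),
   fun i => F i)

/-- `w` is a solution, on the time interval `J` containing `0`, of the closed-loop initial-value
problem with initial state `w₀`. The feedback is defined on `Ω` only, so a solution takes values
in `Ω`; derivatives at end points of `J` are one-sided. -/
structure IsSolutionOn (P : RingRoad n) (w₀ : State n) (J : Set ℝ) (w : ℝ → State n) : Prop where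
  init : w 0 = w₀
  mem : ∀ t ∈ J, w t ∈ P.Ω
  deriv : ∀ t ∈ J, HasDerivWithinAt w (P.bicycle (w t) (P.F (w t)) (P.δ (w t))) J t

end RingRoad

end

/-! `HR` is a Lyapunov function, and the feedback is read off from its differential. Collecting
partial derivatives, `q`, `ζ`, `γ`, `Z`, `Φ` are exactly the coefficients that appear in `dHR`.
Substituting the closed loop cancels all indefinite terms. What remains is minus the `dissipation`,
two viscous sums that are nonpositive because `κ` is symmetric and the `g`'s are monotone, and a
multiple of `∑ Φ i`, which vanishes by antisymmetry (`dHR_field_le`).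

Sublevel sets of `HR` keep a distance from the boundary of `Ω`, so they are closed in the whole
space (`isClosed_sublevel`). They are unbounded only in the angles, in which all relevant functions
are `2π`-periodic. They are therefore compact modulo translations, and continuous periodic functions
are bounded on them (`exists_bound_on_sublevel`); this already gives the input bound.

For global existence the field is multiplied by a smooth function of `HR`. The result is bounded and
globally Lipschitz, so it has global integral curves; it is a nonnegative multiple of the true
field, so `HR` still decreases and a curve starting in a sublevel set remains where the factor is
`1`. Conversely, every solution of the true system solves the truncated one, whence uniqueness.

Convergence is Barbalat's lemma, used three times: on the integral of the dissipation, which is at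
most the initial value of `HR`; on `s i`; and on `v i - ω * r i`, whose derivative is `F i` plus a
vanishing term. -/

noncomputable section

/-! ### Global integral curves and Barbalat-type convergence -/

/-- A bounded Lipschitz vector field has global integral curves. -/
theorem exists_global_integralCurve {E : Type*} [NormedAddCommGroup E] [NormedSpace ℝ E]
    [CompleteSpace E] {f : E → E} {K C : NNReal} (hf : LipschitzWith K f) (hC : ∀ x, ‖f x‖ ≤ C)
    (x₀ : E) : ∃ w : ℝ → E, w 0 = x₀ ∧ ∀ t, HasDerivAt w (f (w t)) t := by
  have hex : ∀ a : ℝ, ∃ α : ℝ → E, 0 < a → α 0 = x₀ ∧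
      ∀ t ∈ Icc (-a) a, HasDerivWithinAt α (f (α t)) (Icc (-a) a) t := by
    intro a
    by_cases ha : 0 < a
    · have h0 : (0 : ℝ) ∈ Icc (-a) a := ⟨by linarith, ha.le⟩
      -- The bound `C` holds on the whole space, so a ball of radius `C * a` suffices for the time
      -- span `a`, however large.
      have hpl : IsPicardLindelof (fun _ ↦ f) (⟨0, h0⟩ : Icc (-a) a) x₀ (C * ⟨a, ha.le⟩) 0 C K :=
        IsPicardLindelof.of_time_independent (fun x _ ↦ hC x) hf.lipschitzOnWith
          (by simp; exact le_rfl)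
      obtain ⟨α, h1, h2⟩ := hpl.exists_eq_forall_mem_Icc_hasDerivWithinAt₀
      exact ⟨α, fun _ ↦ ⟨h1, h2⟩⟩
    · exact ⟨0, fun h ↦ absurd h ha⟩
  choose α hα using hex
  have hd : ∀ a, 0 < a → ∀ t ∈ Ioo (-a) a, HasDerivAt (α a) (f (α a t)) t := fun a ha t ht ↦
    ((hα a ha).2 t (Ioo_subset_Icc_self ht)).hasDerivAt (Icc_mem_nhds ht.1 ht.2)
  have heq : ∀ a b, 0 < a → a ≤ b → EqOn (α a) (α b) (Ioo (-a) a) := by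
    intro a b ha hab
    refine ODE_solution_unique_of_mem_Ioo (v := fun _ ↦ f) (s := fun _ ↦ univ) (K := K) (t₀ := 0)
      (fun _ _ ↦ hf.lipschitzOnWith) ⟨by linarith, ha⟩ (fun t ht ↦ ⟨hd a ha t ht, mem_univ _⟩)
      (fun t ht ↦ ⟨hd b (ha.trans_le hab) t ⟨by linarith [ht.1], by linarith [ht.2]⟩, mem_univ _⟩)
      ?_
    rw [(hα a ha).1, (hα b (ha.trans_le hab)).1]
  -- Diagonal gluing: near `t` all the pieces used agree with the single curve `α (|t| + 2)`.
  refine ⟨fun t ↦ α (|t| + 1) t, (hα _ (by positivity)).1, fun t ↦ ?_⟩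
  have hpos : 0 < |t| + 2 := by positivity
  have hat : |t| < |t| + 1 := by linarith
  have key : ∀ τ, |τ| < |t| + 1 → α (|τ| + 1) τ = α (|t| + 2) τ := fun τ hτ ↦
    heq _ _ (by positivity) (by linarith) ⟨by linarith [neg_abs_le τ], by linarith [le_abs_self τ]⟩
  have h := hd _ hpos t ⟨by linarith [neg_abs_le t], by linarith [le_abs_self t]⟩
  rw [← key t hat] at h
  refine h.congr_of_eventuallyEq ?_
  filter_upwards [continuous_abs.continuousAt.eventually_lt_const hat] with τ hτ using key τ hτ

/-- **Barbalat's lemma**: if `h` converges and its derivative is Lipschitz, then the derivative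
tends to zero. -/
theorem tendsto_deriv_zero_of_tendsto {h k : ℝ → ℝ} {l : ℝ} {C : NNReal}
    (hk : LipschitzWith C k) (hd : ∀ t, 0 ≤ t → HasDerivAt h (k t) t)
    (hl : Tendsto h atTop (𝓝 l)) : Tendsto k atTop (𝓝 0) := by
  rw [Metric.tendsto_atTop]
  intro ε hε
  -- On a window of length `d` the derivative varies by at most `ε / 2`, while `h` changes by less
  -- than `d * ε / 2` at late times; so `d * |k t| < d * ε`.
  obtain ⟨d, hd0, hdε⟩ : ∃ d : ℝ, 0 < d ∧ C * d ≤ ε / 2 := by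
    refine ⟨ε / 2 / (C + 1), by positivity, ?_⟩
    rw [mul_div_assoc', div_le_iff₀ (by positivity)]
    nlinarith [C.coe_nonneg]
  obtain ⟨N, hN⟩ := Metric.tendsto_atTop.1 hl (d * ε / 4) (by positivity)
  refine ⟨max N 0, fun t ht ↦ ?_⟩
  have ht0 : 0 ≤ t := le_trans (le_max_right _ _) ht
  have h1 := hN t (le_trans (le_max_left _ _) ht)
  have h2 := hN (t + d) (by linarith [le_trans (le_max_left _ _) ht])
  have h3 : ‖(h (t + d) - (t + d) * k t) - (h t - t * k t)‖ ≤ C * d * ‖t + d - t‖ := by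
    refine Convex.norm_image_sub_le_of_norm_hasDerivWithin_le
      (f := fun τ ↦ h τ - τ * k t) (f' := fun τ ↦ k τ - 1 * k t) (s := Icc t (t + d))
      (fun τ hτ ↦ ((hd τ (ht0.trans hτ.1)).sub
        ((hasDerivAt_id τ).mul_const (k t))).hasDerivWithinAt) (fun τ hτ ↦ ?_) (convex_Icc _ _)
      ⟨le_rfl, by linarith⟩ ⟨by linarith, le_rfl⟩
    have := hk.dist_le_mul τ t
    rw [one_mul, ← dist_eq_norm]
    refine this.trans ?_
    gcongr
    rw [Real.dist_eq, abs_of_nonneg (by linarith [hτ.1])]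
    linarith [hτ.2]
  rw [Real.dist_eq] at h1 h2 ⊢
  rw [add_sub_cancel_left, Real.norm_eq_abs, Real.norm_eq_abs, abs_of_pos hd0] at h3
  have h4 : C * d * d ≤ ε / 2 * d := by gcongr
  rw [abs_lt] at h1 h2
  have h5 := abs_le.1 (h3.trans h4)
  rw [sub_zero, abs_lt]
  constructor <;> nlinarith

/-- A nonnegative function whose decrease rate dominates a nonnegative Lipschitz function `W`
forces `W` to tend to zero. -/
theorem tendsto_zero_of_dissipation {H H' W : ℝ → ℝ} {C : NNReal} (hW : LipschitzWith C W)
    (hH : ∀ t, 0 ≤ t → 0 ≤ H t) (hd : ∀ t, 0 ≤ t → HasDerivAt H (H' t) t)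
    (hle : ∀ t, 0 ≤ t → H' t ≤ -W t) (hW0 : ∀ t, 0 ≤ t → 0 ≤ W t) :
    Tendsto W atTop (𝓝 0) := by
  have hI : ∀ t, HasDerivAt (fun t ↦ ∫ τ in (0 : ℝ)..t, W τ) (W t) t := fun t ↦
    hW.continuous.integral_hasStrictDerivAt 0 t |>.hasDerivAt
  have hanti : AntitoneOn (fun t ↦ H t + ∫ τ in (0 : ℝ)..t, W τ) (Ici 0) := by
    refine antitoneOn_of_hasDerivWithinAt_nonpos (convex_Ici 0) (f' := fun t ↦ H' t + W t)
      (fun t ht ↦ ((hd t ht).add (hI t)).continuousAt.continuousWithinAt)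
      (fun t ht ↦ ?_) (fun t ht ↦ ?_) <;> rw [interior_Ici] at ht
    · exact ((hd t (le_of_lt ht)).add (hI t)).hasDerivWithinAt
    · linarith [hle t (le_of_lt ht)]
  have hmono : MonotoneOn (fun t ↦ ∫ τ in (0 : ℝ)..t, W τ) (Ici 0) := by
    refine monotoneOn_of_hasDerivWithinAt_nonneg (convex_Ici 0) (f' := W)
      (fun t _ ↦ (hI t).continuousAt.continuousWithinAt)
      (fun t ht ↦ (hI t).hasDerivWithinAt) (fun t ht ↦ ?_)
    rw [interior_Ici] at ht
    exact hW0 t (le_of_lt ht)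
  -- Clamping time at `0` gives monotonicity on the whole line, since `W` is known to be nonnegative
  -- only for `t ≥ 0`. Boundedness comes from `H + ∫ W` being antitone.
  have hmono' : Monotone (fun t ↦ ∫ τ in (0 : ℝ)..(max t 0), W τ) := fun a b hab ↦
    hmono (le_max_right a 0) (le_max_right b 0) (max_le_max_right 0 hab)
  have hbdd : BddAbove (range (fun t ↦ ∫ τ in (0 : ℝ)..(max t 0), W τ)) := by
    refine ⟨H 0, ?_⟩
    rintro _ ⟨t, rfl⟩
    have := hanti (mem_Ici.2 le_rfl) (le_max_right t 0) (le_max_right t 0)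
    simp only [intervalIntegral.integral_same, add_zero] at this
    have := hH (max t 0) (le_max_right t 0)
    simp only
    linarith
  refine tendsto_deriv_zero_of_tendsto hW (fun t _ ↦ hI t)
    ((tendsto_atTop_ciSup hmono' hbdd).congr' ?_)
  filter_upwards [eventually_ge_atTop 0] with t ht
  simp [max_eq_left ht]

/-! ### Smoothness of the coordinates -/

namespace State

variable {n : ℕ}

@[fun_prop]
theorem contDiff_r {m : WithTop ℕ∞} (i : Fin n) : ContDiff ℝ m (fun w : State n ↦ w.r i) := by
  unfold r; fun_prop

@[fun_prop]
theorem contDiff_φ {m : WithTop ℕ∞} (i : Fin n) : ContDiff ℝ m (fun w : State n ↦ w.φ i) := by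
  unfold φ; fun_prop

@[fun_prop]
theorem contDiff_s {m : WithTop ℕ∞} (i : Fin n) : ContDiff ℝ m (fun w : State n ↦ w.s i) := by
  unfold s; fun_prop

@[fun_prop]
theorem contDiff_v {m : WithTop ℕ∞} (i : Fin n) : ContDiff ℝ m (fun w : State n ↦ w.v i) := by
  unfold v; fun_prop

@[fun_prop]
theorem continuous_r (i : Fin n) : Continuous (fun w : State n ↦ w.r i) :=
  (contDiff_r (m := 0) i).continuous

@[fun_prop]
theorem continuous_φ (i : Fin n) : Continuous (fun w : State n ↦ w.φ i) :=
  (contDiff_φ (m := 0) i).continuous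

@[fun_prop]
theorem continuous_s (i : Fin n) : Continuous (fun w : State n ↦ w.s i) :=
  (contDiff_s (m := 0) i).continuous

@[fun_prop]
theorem continuous_v (i : Fin n) : Continuous (fun w : State n ↦ w.v i) :=
  (contDiff_v (m := 0) i).continuous

end State

/-! ### Positivity and regularity of the feedback on `Ω` -/

namespace RingRoad

variable {n : ℕ} {P : RingRoad n} {w : State n}

theorem continuous_dist (P : RingRoad n) (i j : Fin n) :
    Continuous (fun w : State n ↦ P.dist w i j) := by
  unfold dist; fun_prop

theorem isOpen_Ω (P : RingRoad n) : IsOpen P.Ω := by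
  have : P.Ω = (⋂ i, {w | w.r i ∈ Ioo P.Rin P.Rout}) ∩ ((⋂ i, {w | w.s i ∈ Ioo (-P.Θ) P.Θ}) ∩
      ((⋂ i, {w | w.v i ∈ Ioo 0 P.vmax}) ∩
        ⋂ i, ⋂ j, ⋂ _ : j ≠ i, {w | P.L i j < P.dist w i j})) := by
    ext w; simp [Ω]
  rw [this]
  refine IsOpen.inter (isOpen_iInter_of_finite fun i ↦ isOpen_Ioo.preimage (by fun_prop)) <|
    IsOpen.inter (isOpen_iInter_of_finite fun i ↦ isOpen_Ioo.preimage (by fun_prop)) <|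
    IsOpen.inter (isOpen_iInter_of_finite fun i ↦ isOpen_Ioo.preimage (by fun_prop)) <|
    isOpen_iInter_of_finite fun i ↦ isOpen_iInter_of_finite fun j ↦ isOpen_iInter_of_finite
      fun _ ↦ isOpen_lt continuous_const (P.continuous_dist i j)

/-- The angular speed error of vehicle `i`. -/
def err (P : RingRoad n) (w : State n) (i : Fin n) : ℝ :=
  w.v i / w.r i * Real.cos (w.s i) - P.ω

namespace IsAdmissible

theorem r_pos (hP : P.IsAdmissible) (hw : w ∈ P.Ω) (i : Fin n) : 0 < w.r i :=
  hP.Rin_pos.trans (hw.1 i).1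

theorem Rout_mul_ω_lt (hP : P.IsAdmissible) : P.Rout * P.ω < P.vmax * Real.cos P.Θ := by
  have := hP.cos_Θ
  rwa [div_lt_iff₀ hP.vmax_pos, mul_comm (Real.cos _)] at this

theorem cos_Θ_pos (hP : P.IsAdmissible) : 0 < Real.cos P.Θ :=
  Real.cos_pos_of_mem_Ioo ⟨by linarith [hP.Θ_pos, Real.pi_pos], hP.Θ_lt⟩

theorem cos_Θ_le_cos (hP : P.IsAdmissible) {x : ℝ} (hx : |x| ≤ P.Θ) :
    Real.cos P.Θ ≤ Real.cos x := by
  rw [← Real.cos_abs x]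
  exact Real.cos_le_cos_of_nonneg_of_le_pi (abs_nonneg x)
    (by linarith [hP.Θ_lt, Real.pi_pos]) hx

theorem cos_s_sub_pos (hP : P.IsAdmissible) (hw : w ∈ P.Ω) (i : Fin n) :
    0 < Real.cos (w.s i) - Real.cos P.Θ := by
  rw [sub_pos, ← Real.cos_abs (w.s i)]
  exact Real.cos_lt_cos_of_nonneg_of_le_pi (abs_nonneg _)
    (by linarith [hP.Θ_lt, Real.pi_pos]) (abs_lt.2 (hw.2.1 i))

theorem cos_s_pos (hP : P.IsAdmissible) (hw : w ∈ P.Ω) (i : Fin n) : 0 < Real.cos (w.s i) := by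
  linarith [hP.cos_s_sub_pos hw i, hP.cos_Θ_pos]

theorem dist_pos (hP : P.IsAdmissible) (hw : w ∈ P.Ω) {i j : Fin n} (hij : j ≠ i) :
    0 < P.dist w i j :=
  (hP.L_pos i j hij.symm).trans (hw.2.2.2 i j hij)

theorem dist_comm (hP : P.IsAdmissible) (w : State n) (i j : Fin n) :
    P.dist w i j = P.dist w j i := by
  unfold dist
  rw [hP.p_symm i j, ← Real.cos_neg (w.φ i - w.φ j), neg_sub]
  ring_nf

/-- The numerator equals `v * (vmax * cos s - r * ω) + r * ω * (vmax - v)`. The first bracket is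
positive by the condition on `cos Θ`, since `r < Rout` and `cos s > cos Θ`. -/
theorem q_pos (hP : P.IsAdmissible) (hw : w ∈ P.Ω) (i : Fin n) :
    0 < P.q (w.r i) (w.s i) (w.v i) := by
  have hr := hP.r_pos hw i
  obtain ⟨hv, hv'⟩ := hw.2.2.1 i
  have h1 : w.r i * P.ω < P.vmax * Real.cos (w.s i) := by
    nlinarith [hP.Rout_mul_ω_lt, hP.cos_s_sub_pos hw i, hP.vmax_pos, hP.ω_pos, (hw.1 i).2]
  have h2 : 0 < P.vmax - w.v i := by linarith
  have h3 : 0 < w.r i * P.ω := mul_pos hr hP.ω_pos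
  unfold q
  refine div_pos ?_ (by positivity)
  nlinarith

/-- This is where `b > 1 / Rin ^ 2` enters: it makes `b - 1 / r ^ 2` positive, and all three
summands are then positive. -/
theorem γ_pos (hP : P.IsAdmissible) (hw : w ∈ P.Ω) (i : Fin n) :
    0 < P.γ (w.r i) (w.s i) (w.v i) := by
  have hr := hP.r_pos hw i
  obtain ⟨hv, hv'⟩ := hw.2.2.1 i
  have h2 : 0 < P.vmax - w.v i := by linarith
  have hc := hP.cos_s_pos hw i
  have hc' := hP.cos_s_sub_pos hw i
  have hA := hP.A_pos
  have hω := hP.ω_pos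
  have hb : 0 < P.b - 1 / w.r i ^ 2 := by
    have h3 : 1 / w.r i ^ 2 ≤ 1 / P.Rin ^ 2 :=
      one_div_le_one_div_of_le (pow_pos hP.Rin_pos 2)
        (pow_le_pow_left₀ hP.Rin_pos.le (hw.1 i).1.le 2)
    linarith [hP.b_gt]
  unfold γ
  positivity

theorem contDiffOn_dist (hP : P.IsAdmissible) {i j : Fin n} (hij : j ≠ i) :
    ContDiffOn ℝ 1 (fun w : State n ↦ P.dist w i j) P.Ω := by
  unfold dist
  refine ContDiffOn.sqrt (by fun_prop) fun w hw h0 ↦ ?_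
  have := hP.dist_pos hw hij
  rw [dist, h0, Real.sqrt_zero] at this
  exact lt_irrefl _ this

theorem mapsTo_dist {i j : Fin n} (hij : j ≠ i) :
    MapsTo (fun w : State n ↦ P.dist w i j) P.Ω (Ioi (P.L i j)) :=
  fun _ hw ↦ hw.2.2.2 i j hij

theorem contDiffOn_V (hP : P.IsAdmissible) {i j : Fin n} (hij : j ≠ i) :
    ContDiffOn ℝ 1 (fun w : State n ↦ P.V i j (P.dist w i j)) P.Ω :=
  ((hP.V_contDiffOn i j hij.symm).of_le (by norm_num)).comp (hP.contDiffOn_dist hij)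
    (mapsTo_dist hij)

theorem contDiffOn_deriv_V (hP : P.IsAdmissible) {i j : Fin n} (hij : j ≠ i) :
    ContDiffOn ℝ 1 (fun w : State n ↦ deriv (P.V i j) (P.dist w i j)) P.Ω :=
  ((hP.V_contDiffOn i j hij.symm).deriv_of_isOpen isOpen_Ioi (by norm_num)).comp
    (hP.contDiffOn_dist hij) (mapsTo_dist hij)

theorem contDiffOn_κ (hP : P.IsAdmissible) {i j : Fin n} (hij : j ≠ i) :
    ContDiffOn ℝ 1 (fun w : State n ↦ P.κ i j (P.dist w i j)) P.Ω :=
  (hP.κ_contDiffOn i j hij.symm).comp (hP.contDiffOn_dist hij) (mapsTo_dist hij)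

theorem contDiffOn_U (hP : P.IsAdmissible) (i : Fin n) :
    ContDiffOn ℝ 1 (fun w : State n ↦ P.U i (w.r i)) P.Ω :=
  ((hP.U_contDiffOn i).of_le (by norm_num)).comp (by fun_prop) fun _ hw ↦ hw.1 i

theorem contDiffOn_deriv_U (hP : P.IsAdmissible) (i : Fin n) :
    ContDiffOn ℝ 1 (fun w : State n ↦ deriv (P.U i) (w.r i)) P.Ω :=
  ((hP.U_contDiffOn i).deriv_of_isOpen isOpen_Ioo (by norm_num)).comp (by fun_prop)
    fun _ hw ↦ hw.1 i

theorem contDiffOn_angularSpeed (hP : P.IsAdmissible) (i : Fin n) :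
    ContDiffOn ℝ 1 (fun w : State n ↦ w.v i / w.r i * Real.cos (w.s i)) P.Ω :=
  (ContDiffOn.div (by fun_prop) (by fun_prop) fun _ hw ↦ (hP.r_pos hw i).ne').mul (by fun_prop)

theorem contDiffOn_err (hP : P.IsAdmissible) (i : Fin n) :
    ContDiffOn ℝ 1 (fun w : State n ↦ P.err w i) P.Ω :=
  (hP.contDiffOn_angularSpeed i).sub contDiffOn_const

theorem contDiffOn_HR (hP : P.IsAdmissible) : ContDiffOn ℝ 1 P.HR P.Ω := by
  unfold HR
  refine ContDiffOn.add (ContDiffOn.add (ContDiffOn.add ?_ ?_) ?_) ?_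
  · refine contDiffOn_const.mul (ContDiffOn.sum fun i _ ↦ ContDiffOn.div ?_ (by fun_prop) ?_)
    · exact ((hP.contDiffOn_err i).pow 2).add (by fun_prop)
    · intro w hw
      have := hw.2.2.1 i
      exact (mul_pos (sub_pos.2 this.2) this.1).ne'
  · exact ContDiffOn.sum fun i _ ↦ hP.contDiffOn_U i
  · exact contDiffOn_const.mul (ContDiffOn.sum fun i _ ↦ ContDiffOn.sum fun j hj ↦
      hP.contDiffOn_V (Finset.ne_of_mem_erase hj))
  · refine contDiffOn_const.mul (ContDiffOn.sum fun i _ ↦ ContDiffOn.sub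
      (ContDiffOn.div (by fun_prop) (by fun_prop) ?_) contDiffOn_const)
    exact fun w hw ↦ (hP.cos_s_sub_pos hw i).ne'

theorem contDiffOn_Φ (hP : P.IsAdmissible) (i : Fin n) :
    ContDiffOn ℝ 1 (fun w ↦ P.Φ w i) P.Ω := by
  unfold Φ
  refine ContDiffOn.mul (by fun_prop) (ContDiffOn.sum fun j hj ↦ ?_)
  have hij := Finset.ne_of_mem_erase hj
  exact (hP.contDiffOn_deriv_V hij).mul (ContDiffOn.div (by fun_prop) (hP.contDiffOn_dist hij)
    fun w hw ↦ (hP.dist_pos hw hij).ne')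

theorem contDiffOn_G (hP : P.IsAdmissible) (i : Fin n) :
    ContDiffOn ℝ 1 (fun w ↦ P.G w i) P.Ω := by
  unfold G
  refine ContDiffOn.mul (by fun_prop) (ContDiffOn.sum fun j hj ↦ ?_)
  exact (hP.contDiffOn_κ (Finset.ne_of_mem_erase hj)).mul
    ((hP.g₁_contDiff.comp_contDiffOn (hP.contDiffOn_angularSpeed j)).sub
      (hP.g₁_contDiff.comp_contDiffOn (hP.contDiffOn_angularSpeed i)))

theorem contDiffOn_M (hP : P.IsAdmissible) (i : Fin n) :
    ContDiffOn ℝ 1 (fun w ↦ P.M w i) P.Ω := by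
  unfold M
  refine ContDiffOn.sum fun j hj ↦ ?_
  exact (hP.contDiffOn_κ (Finset.ne_of_mem_erase hj)).mul
    ((hP.g₂_contDiff.comp_contDiffOn (by fun_prop)).sub
      (hP.g₂_contDiff.comp_contDiffOn (by fun_prop)))

theorem contDiffOn_q (hP : P.IsAdmissible) (i : Fin n) :
    ContDiffOn ℝ 1 (fun w : State n ↦ P.q (w.r i) (w.s i) (w.v i)) P.Ω := by
  unfold q
  refine ContDiffOn.div (by fun_prop) (by fun_prop) fun w hw ↦ ?_
  have hr := hP.r_pos hw i
  obtain ⟨hv, hv'⟩ := hw.2.2.1 i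
  have h2 : 0 < P.vmax - w.v i := by linarith
  positivity

theorem contDiffOn_γ (hP : P.IsAdmissible) (i : Fin n) :
    ContDiffOn ℝ 1 (fun w : State n ↦ P.γ (w.r i) (w.s i) (w.v i)) P.Ω := by
  unfold γ
  have hv : ∀ w ∈ P.Ω, P.vmax - w.v i ≠ 0 := fun w hw ↦ (sub_pos.2 (hw.2.2.1 i).2).ne'
  have hr : ∀ w ∈ P.Ω, w.r i ≠ 0 := fun w hw ↦ (hP.r_pos hw i).ne'
  refine ContDiffOn.add (ContDiffOn.add ?_ (ContDiffOn.mul ?_ (ContDiffOn.sub contDiffOn_const ?_)))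
    ?_
  · exact ContDiffOn.div (by fun_prop) (by fun_prop)
      fun w hw ↦ pow_ne_zero 2 (hP.cos_s_sub_pos hw i).ne'
  · exact ContDiffOn.div (by fun_prop) (by fun_prop) hv
  · exact ContDiffOn.div (by fun_prop) (by fun_prop) fun w hw ↦ pow_ne_zero 2 (hr w hw)
  · exact ContDiffOn.div (by fun_prop) (by fun_prop) fun w hw ↦ mul_ne_zero (hr w hw) (hv w hw)

theorem contDiffOn_ζ (i : Fin n) :
    ContDiffOn ℝ 1 (fun w : State n ↦ P.ζ (w.s i) (w.v i)) P.Ω := by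
  unfold ζ
  refine ContDiffOn.div (by fun_prop) (by fun_prop) fun w hw ↦ ?_
  obtain ⟨hv, hv'⟩ := hw.2.2.1 i
  have h2 : 0 < P.vmax - w.v i := by linarith
  positivity

theorem contDiffOn_Z (hP : P.IsAdmissible) (i : Fin n) :
    ContDiffOn ℝ 1 (fun w ↦ P.Z w i) P.Ω := by
  unfold Z
  refine ContDiffOn.sub (ContDiffOn.sub (ContDiffOn.mul (hP.contDiffOn_err i) ?_)
    (hP.contDiffOn_deriv_U i)) (ContDiffOn.sum fun j hj ↦ ?_)
  · refine ContDiffOn.div (by fun_prop) (by fun_prop) fun w hw ↦ ?_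
    exact mul_ne_zero (sub_pos.2 (hw.2.2.1 i).2).ne' (pow_ne_zero 2 (hP.r_pos hw i).ne')
  · have hij := Finset.ne_of_mem_erase hj
    exact ContDiffOn.mul (by fun_prop) ((hP.contDiffOn_deriv_V hij).div (hP.contDiffOn_dist hij)
      fun w hw ↦ (hP.dist_pos hw hij).ne')

theorem contDiffOn_F (hP : P.IsAdmissible) (i : Fin n) :
    ContDiffOn ℝ 1 (fun w ↦ P.F w i) P.Ω := by
  unfold F
  refine ContDiffOn.mul (ContDiffOn.neg (ContDiffOn.div contDiffOn_const (hP.contDiffOn_q i)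
    fun w hw ↦ (hP.q_pos hw i).ne')) (ContDiffOn.add ?_ ?_)
  · exact hP.f₁_contDiff.comp_contDiffOn (hP.contDiffOn_err i)
  · exact contDiffOn_const.mul ((hP.contDiffOn_Φ i).sub (hP.contDiffOn_G i))

/-- The `arctan` in the control law cancels the `tan` in the vehicle model, so the poles of `tan`
play no role. -/
theorem contDiffOn_tan_δ (hP : P.IsAdmissible) (i : Fin n) :
    ContDiffOn ℝ 1 (fun w ↦ Real.tan (P.δ w i)) P.Ω := by
  simp only [δ, Real.tan_arctan]
  have hr : ∀ w ∈ P.Ω, w.r i ≠ 0 := fun w hw ↦ (hP.r_pos hw i).ne'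
  refine ContDiffOn.sub (ContDiffOn.mul (ContDiffOn.div contDiffOn_const (by fun_prop) hr)
    (by fun_prop)) (ContDiffOn.mul (ContDiffOn.div contDiffOn_const
      ((hP.contDiffOn_γ i).mul (by fun_prop)) fun w hw ↦ ?_)
      (ContDiffOn.sub (ContDiffOn.add ?_ (ContDiffOn.mul (ContDiffOn.add ?_ ?_) ?_)) ?_))
  · exact mul_ne_zero (hP.γ_pos hw i).ne' (hw.2.2.1 i).1.ne'
  · exact hP.f₂_contDiff.comp_contDiffOn (by fun_prop)
  · exact (contDiffOn_ζ i).mul (hP.contDiffOn_F i)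
  · exact hP.contDiffOn_Z i
  · fun_prop
  · exact hP.contDiffOn_M i

theorem contDiffOn_δ (hP : P.IsAdmissible) (i : Fin n) :
    ContDiffOn ℝ 1 (fun w ↦ P.δ w i) P.Ω := by
  refine (Real.contDiff_arctan.comp_contDiffOn (hP.contDiffOn_tan_δ i)).congr fun w _ ↦ ?_
  simp [δ, Real.tan_arctan]

end IsAdmissible

/-- The closed-loop vector field. -/
def field (P : RingRoad n) (w : State n) : State n := P.bicycle w (P.F w) (P.δ w)

namespace IsAdmissible

theorem contDiffOn_field (hP : P.IsAdmissible) : ContDiffOn ℝ 1 P.field P.Ω := by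
  unfold field bicycle
  refine ContDiffOn.prodMk (contDiffOn_pi.2 fun i ↦ by fun_prop) <|
    ContDiffOn.prodMk (contDiffOn_pi.2 fun i ↦ hP.contDiffOn_angularSpeed i) <|
    ContDiffOn.prodMk (contDiffOn_pi.2 fun i ↦ ?_) (contDiffOn_pi.2 fun i ↦ hP.contDiffOn_F i)
  exact (ContDiffOn.mul (by fun_prop) (hP.contDiffOn_tan_δ i)).sub (hP.contDiffOn_angularSpeed i)

end IsAdmissible

end RingRoad

/-! ### Symmetrisation of sums over ordered pairs -/

section OffDiagonalSums

variable {n : ℕ}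

theorem sum_erase_comm (f : Fin n → Fin n → ℝ) :
    ∑ i, ∑ j ∈ Finset.univ.erase i, f i j = ∑ i, ∑ j ∈ Finset.univ.erase i, f j i :=
  Finset.sum_comm' fun i j ↦ by simp [eq_comm]

theorem half_sum_erase_eq {f g : Fin n → Fin n → ℝ}
    (h : ∀ i j, j ≠ i → f i j = g i j + g j i) :
    1 / 2 * ∑ i, ∑ j ∈ Finset.univ.erase i, f i j
      = ∑ i, ∑ j ∈ Finset.univ.erase i, g i j := by
  have : ∑ i, ∑ j ∈ Finset.univ.erase i, f i j
      = ∑ i, ∑ j ∈ Finset.univ.erase i, g i j + ∑ i, ∑ j ∈ Finset.univ.erase i, g j i := by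
    simp only [← Finset.sum_add_distrib]
    exact Finset.sum_congr rfl fun i _ ↦ Finset.sum_congr rfl fun j hj ↦
      h i j (Finset.ne_of_mem_erase hj)
  rw [this, ← sum_erase_comm g]
  ring

theorem sum_erase_eq_zero_of_antisymm {f : Fin n → Fin n → ℝ}
    (h : ∀ i j, j ≠ i → f i j = -f j i) :
    ∑ i, ∑ j ∈ Finset.univ.erase i, f i j = 0 := by
  rw [← half_sum_erase_eq (f := fun _ _ ↦ (0 : ℝ)) fun i j hij ↦ by rw [h i j hij]; ring]
  simp

/-- Symmetrising turns each term into `k i j * (x i - x j) * (g (y j) - g (y i))`, where the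
differences have opposite signs. The shift `c` allows for the angular speed error (`c = ω`) as well
as for `sin s` (`c = 0`). -/
theorem sum_viscous_nonpos {k : Fin n → Fin n → ℝ} {x y : Fin n → ℝ} {g : ℝ → ℝ}
    (hg : Monotone g) (hk : ∀ i j, j ≠ i → 0 ≤ k i j) (hk' : ∀ i j, j ≠ i → k i j = k j i)
    (c : ℝ) (hxy : ∀ i, y i = x i + c) :
    ∑ i, ∑ j ∈ Finset.univ.erase i, x i * (k i j * (g (y j) - g (y i))) ≤ 0 := by
  rw [← half_sum_erase_eq (f := fun i j ↦ k i j * ((x i - x j) * (g (y j) - g (y i))))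
    fun i j hij ↦ by rw [hk' j i hij.symm]; ring]
  suffices ∑ i, ∑ j ∈ Finset.univ.erase i, k i j * ((x i - x j) * (g (y j) - g (y i))) ≤ 0 by
    linarith
  refine Finset.sum_nonpos fun i _ ↦ Finset.sum_nonpos fun j hj ↦
    mul_nonpos_of_nonneg_of_nonpos (hk i j (Finset.ne_of_mem_erase hj)) ?_
  rcases le_total (x i) (x j) with h | h
  · exact mul_nonpos_of_nonpos_of_nonneg (by linarith)
      (sub_nonneg.2 (hg (by rw [hxy, hxy]; linarith)))
  · exact mul_nonpos_of_nonneg_of_nonpos (by linarith)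
      (sub_nonpos.2 (hg (by rw [hxy, hxy]; linarith)))

end OffDiagonalSums

/-! ### The derivative of `HR` along the closed loop -/

namespace RingRoad

variable {n : ℕ} {P : RingRoad n} {w : State n}

/-- The differential of `HR` at `w`, applied to `u`. -/
def dHR (P : RingRoad n) (w u : State n) : ℝ :=
  ∑ i, ((P.err w i * P.q (w.r i) (w.s i) (w.v i)
        + w.v i * Real.sin (w.s i) * P.ζ (w.s i) (w.v i)) * u.v i
      + Real.sin (w.s i) * P.γ (w.r i) (w.s i) (w.v i) * u.s i
      - P.Z w i * u.r i + P.ω * P.Φ w i * u.φ i)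

/-- The dissipation rate of `HR` due to the friction terms `f₁`, `f₂`. -/
def dissipation (P : RingRoad n) (w : State n) : ℝ :=
  ∑ i, (P.err w i * P.f₁ (P.err w i) + Real.sin (w.s i) * P.f₂ (Real.sin (w.s i)))

theorem dHR_smul (P : RingRoad n) (w u : State n) (c : ℝ) :
    P.dHR w (c • u) = c * P.dHR w u := by
  unfold dHR
  rw [Finset.mul_sum]
  refine Finset.sum_congr rfl fun i _ ↦ ?_
  simp only [State.r, State.φ, State.s, State.v, Prod.smul_fst, Prod.smul_snd, Pi.smul_apply,
    smul_eq_mul]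
  ring

/-- The result is grouped to expose `q`, `ζ`, the part of `γ` without `A`, and the first term of
`Z`. The factor `2` absorbs the `1 / 2` in `HR`. -/
theorem hasDerivWithinAt_kinetic {b ω vm : ℝ} {r s v : ℝ → ℝ} {r' s' v' t : ℝ} {J : Set ℝ}
    (hr : HasDerivWithinAt r r' J t) (hs : HasDerivWithinAt s s' J t)
    (hv : HasDerivWithinAt v v' J t) (hr0 : r t ≠ 0) (hv0 : v t ≠ 0) (hv1 : vm - v t ≠ 0) :
    HasDerivWithinAt (fun τ ↦ ((v τ / r τ * Real.cos (s τ) - ω) ^ 2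
        + b * v τ ^ 2 * Real.sin (s τ) ^ 2) / ((vm - v τ) * v τ))
      (2 * (((v t / r t * Real.cos (s t) - ω) * ((vm * v t * Real.cos (s t) - 2 * r t * v t * ω
            + r t * ω * vm) / (2 * r t * (vm - v t) ^ 2 * v t ^ 2))
          + v t * Real.sin (s t) * (b * vm * Real.sin (s t) / (2 * (vm - v t) ^ 2 * v t))) * v'
        + Real.sin (s t) * (v t * Real.cos (s t) / (vm - v t) * (b - 1 / r t ^ 2)
            + ω / (r t * (vm - v t))) * s'
        - (v t / r t * Real.cos (s t) - ω) * (Real.cos (s t) / ((vm - v t) * r t ^ 2)) * r')) J t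
    := by
  have h := (((((hv.div hr hr0).mul hs.cos).sub_const ω).pow 2).add
    (((hv.pow 2).const_mul b).mul (hs.sin.pow 2))).div ((hv.const_sub vm).mul hv)
    (mul_ne_zero hv1 hv0)
  refine h.congr_deriv ?_
  simp only [Pi.add_apply, Pi.mul_apply, Pi.div_apply, Pi.pow_apply, Nat.reduceSub, pow_one,
    Nat.cast_ofNat]
  field_simp
  ring

theorem hasDerivWithinAt_barrier {c₀ c₁ : ℝ} {s : ℝ → ℝ} {s' t : ℝ} {J : Set ℝ}
    (hs : HasDerivWithinAt s s' J t) (h0 : Real.cos (s t) - c₀ ≠ 0) :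
    HasDerivWithinAt (fun τ ↦ 1 / (Real.cos (s τ) - c₀) - c₁)
      (Real.sin (s t) * (1 / (Real.cos (s t) - c₀) ^ 2) * s') J t := by
  have h := ((hasDerivWithinAt_const t J (1 : ℝ)).div (hs.cos.sub_const c₀) h0).sub_const c₁
  refine h.congr_deriv ?_
  field_simp
  ring

namespace IsAdmissible

/-- Symmetry of `V` is assumed only beyond `L i j`, but that half-line is open, so it passes to
derivatives there. -/
theorem deriv_V_symm (hP : P.IsAdmissible) (hw : w ∈ P.Ω) {i j : Fin n} (hij : j ≠ i) :
    deriv (P.V i j) (P.dist w i j) = deriv (P.V j i) (P.dist w j i) := by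
  rw [← hP.dist_comm w i j]
  refine Filter.EventuallyEq.deriv_eq ?_
  filter_upwards [isOpen_Ioi.mem_nhds (hw.2.2.2 i j hij)] with d hd using
    hP.V_symm i j hij.symm d hd

theorem hasDerivWithinAt_dist (hP : P.IsAdmissible) {w : ℝ → State n} {u : State n} {J : Set ℝ}
    {t : ℝ} (hu : HasDerivWithinAt w u J t) (hw : w t ∈ P.Ω) {i j : Fin n} (hij : j ≠ i) :
    HasDerivWithinAt (fun τ ↦ P.dist (w τ) i j)
      ((((P.p i j * ((w t).r i - (w t).r j)
            + (w t).r j * (1 - Real.cos ((w t).φ i - (w t).φ j))) * u.r i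
          + (P.p i j * ((w t).r j - (w t).r i)
            + (w t).r i * (1 - Real.cos ((w t).φ i - (w t).φ j))) * u.r j
          + (w t).r i * (w t).r j * Real.sin ((w t).φ i - (w t).φ j) * (u.φ i - u.φ j))
        / P.dist (w t) i j)) J t := by
  have hr := hasDerivWithinAt_pi.1 hu.fst
  have hφ := hasDerivWithinAt_pi.1 hu.snd.fst
  have h0 : P.p i j * ((w t).r i - (w t).r j) ^ 2
      + 2 * (w t).r i * (w t).r j * (1 - Real.cos ((w t).φ i - (w t).φ j)) ≠ 0 := by
    intro h0
    have := hP.dist_pos hw hij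
    rw [dist, h0, Real.sqrt_zero] at this
    exact lt_irrefl _ this
  have h := HasDerivWithinAt.sqrt (((((hr i).sub (hr j)).pow 2).const_mul (P.p i j)).add
    ((((hr i).const_mul 2).mul (hr j)).mul (((hφ i).sub (hφ j)).cos.const_sub 1))) h0
  refine h.congr_deriv ?_
  have hd := (hP.dist_pos hw hij).ne'
  change _ / (2 * P.dist (w t) i j) = _
  rw [div_eq_div_iff (mul_ne_zero two_ne_zero hd) hd]
  simp only [Pi.sub_apply, Pi.mul_apply, State.r, State.φ]
  push_cast
  ring

theorem hasDerivWithinAt_HR (hP : P.IsAdmissible) {w : ℝ → State n} {u : State n} {J : Set ℝ}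
    {t : ℝ} (hu : HasDerivWithinAt w u J t) (hw : w t ∈ P.Ω) :
    HasDerivWithinAt (fun τ ↦ P.HR (w τ)) (P.dHR (w t) u) J t := by
  have hr : ∀ i, HasDerivWithinAt (fun τ ↦ (w τ).r i) (u.r i) J t :=
    hasDerivWithinAt_pi.1 hu.fst
  have hs : ∀ i, HasDerivWithinAt (fun τ ↦ (w τ).s i) (u.s i) J t :=
    hasDerivWithinAt_pi.1 hu.snd.snd.fst
  have hv : ∀ i, HasDerivWithinAt (fun τ ↦ (w τ).v i) (u.v i) J t :=
    hasDerivWithinAt_pi.1 hu.snd.snd.snd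
  have hK := (HasDerivWithinAt.fun_sum (u := Finset.univ) fun i _ ↦
    hasDerivWithinAt_kinetic (b := P.b) (ω := P.ω) (vm := P.vmax) (hr i) (hs i) (hv i)
      (hP.r_pos hw i).ne' (hw.2.2.1 i).1.ne' (sub_pos.2 (hw.2.2.1 i).2).ne').const_mul (1 / 2 : ℝ)
  have hA := (HasDerivWithinAt.fun_sum (u := Finset.univ) fun i _ ↦
    hasDerivWithinAt_barrier (c₁ := 1 / (1 - Real.cos P.Θ)) (hs i)
      (hP.cos_s_sub_pos hw i).ne').const_mul P.A
  have hU := HasDerivWithinAt.fun_sum (u := Finset.univ) fun i _ ↦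
    ((((hP.U_contDiffOn i).differentiableOn (by norm_num)).differentiableAt
      (isOpen_Ioo.mem_nhds (hw.1 i))).hasDerivAt.comp_hasDerivWithinAt t (hr i))
  have hV := (HasDerivWithinAt.fun_sum (u := Finset.univ) fun i _ ↦
    HasDerivWithinAt.fun_sum (u := Finset.univ.erase i) fun j hj ↦
      ((((hP.V_contDiffOn i j (Finset.ne_of_mem_erase hj).symm).differentiableOn
        (by norm_num)).differentiableAt
        (isOpen_Ioi.mem_nhds
          (hw.2.2.2 i j (Finset.ne_of_mem_erase hj)))).hasDerivAt).comp_hasDerivWithinAt t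
        (hP.hasDerivWithinAt_dist hu hw (Finset.ne_of_mem_erase hj))).const_mul (1 / 2 : ℝ)
  refine (((hK.add hU).add hV).add hA).congr_deriv ?_
  -- The derivative of each pair potential splits into a part carried by `u i` and its mirror image
  -- carried by `u j`; this removes the `1 / 2` and leaves one sum over `i`.
  rw [half_sum_erase_eq (g := fun i j ↦
    (((P.p i j * ((w t).r i - (w t).r j) + (w t).r j * (1 - Real.cos ((w t).φ i - (w t).φ j)))
      * (deriv (P.V i j) (P.dist (w t) i j) / P.dist (w t) i j)) * u.r i
      + ((w t).r i * (deriv (P.V i j) (P.dist (w t) i j) *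
        ((w t).r j * Real.sin ((w t).φ i - (w t).φ j) / P.dist (w t) i j))) * u.φ i))]
  · simp only [Finset.mul_sum, ← Finset.sum_add_distrib, dHR]
    refine Finset.sum_congr rfl fun i _ ↦ ?_
    have hω := hP.ω_pos.ne'
    have h1 : P.ω * P.Φ (w t) i = ∑ j ∈ Finset.univ.erase i, (w t).r i *
        (deriv (P.V i j) (P.dist (w t) i j) *
          ((w t).r j * Real.sin ((w t).φ i - (w t).φ j) / P.dist (w t) i j)) := by
      rw [Φ, ← Finset.mul_sum, ← mul_assoc, mul_div_cancel₀ _ hω]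
    rw [h1, Z, Finset.sum_add_distrib, ← Finset.sum_mul, ← Finset.sum_mul, err, q, ζ, γ]
    ring
  · intro i j hij
    have hc : Real.cos ((w t).φ j - (w t).φ i) = Real.cos ((w t).φ i - (w t).φ j) := by
      rw [← Real.cos_neg, neg_sub]
    have hsn : Real.sin ((w t).φ j - (w t).φ i) = -Real.sin ((w t).φ i - (w t).φ j) := by
      rw [← Real.sin_neg, neg_sub]
    rw [← hP.deriv_V_symm hw hij, ← hP.dist_comm (w t) i j, hP.p_symm j i, hc, hsn]
    ring

/-- Action equals reaction: the pair terms are symmetric except for the odd factor `sin (φ i - φ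
j)`. -/
theorem sum_Φ (hP : P.IsAdmissible) (hw : w ∈ P.Ω) : ∑ i, P.Φ w i = 0 := by
  simp only [Φ, Finset.mul_sum]
  refine sum_erase_eq_zero_of_antisymm fun i j hij ↦ ?_
  have hsn : Real.sin (w.φ j - w.φ i) = -Real.sin (w.φ i - w.φ j) := by
    rw [← Real.sin_neg, neg_sub]
  rw [← hP.deriv_V_symm hw hij, ← hP.dist_comm w i j, hsn]
  ring

theorem sum_err_mul_G (hP : P.IsAdmissible) (hw : w ∈ P.Ω) :
    ∑ i, P.err w i * (P.ω * P.G w i) ≤ 0 := by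
  have hω := hP.ω_pos.ne'
  have : ∀ i, P.ω * P.G w i = ∑ j ∈ Finset.univ.erase i, P.κ i j (P.dist w i j) *
    (P.g₁ (w.v j / w.r j * Real.cos (w.s j)) - P.g₁ (w.v i / w.r i * Real.cos (w.s i))) := by
    intro i
    rw [G, ← mul_assoc, mul_one_div_cancel hω, one_mul]
  simp only [this, Finset.mul_sum]
  refine sum_viscous_nonpos (y := fun i ↦ w.v i / w.r i * Real.cos (w.s i)) hP.g₁_mono
    (fun i j hij ↦ hP.κ_nonneg i j hij.symm _ (hw.2.2.2 i j hij)) (fun i j hij ↦ ?_) P.ω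
    fun i ↦ by simp [err]
  rw [← hP.dist_comm w i j]
  exact hP.κ_symm i j hij.symm _ (hw.2.2.2 i j hij)

theorem sum_sin_mul_M (hP : P.IsAdmissible) (hw : w ∈ P.Ω) :
    ∑ i, Real.sin (w.s i) * P.M w i ≤ 0 := by
  simp only [M, Finset.mul_sum]
  refine sum_viscous_nonpos (y := fun i ↦ Real.sin (w.s i)) hP.g₂_mono
    (fun i j hij ↦ hP.κ_nonneg i j hij.symm _ (hw.2.2.2 i j hij)) (fun i j hij ↦ ?_) 0
    fun i ↦ by simp
  rw [← hP.dist_comm w i j]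
  exact hP.κ_symm i j hij.symm _ (hw.2.2.2 i j hij)

theorem dissipation_term_nonneg (hP : P.IsAdmissible) (w : State n) (i : Fin n) :
    0 ≤ P.err w i * P.f₁ (P.err w i) ∧ 0 ≤ Real.sin (w.s i) * P.f₂ (Real.sin (w.s i)) := by
  constructor
  · rcases eq_or_ne (P.err w i) 0 with h | h
    · simp [h]
    · exact (hP.f₁_sign _ h).le
  · rcases eq_or_ne (Real.sin (w.s i)) 0 with h | h
    · simp [h]
    · exact (hP.f₂_sign _ h).le

theorem dissipation_nonneg (hP : P.IsAdmissible) (w : State n) : 0 ≤ P.dissipation w :=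
  Finset.sum_nonneg fun i _ ↦
    add_nonneg (hP.dissipation_term_nonneg w i).1 (hP.dissipation_term_nonneg w i).2

/-- The steering law cancels the terms in `ζ` and `Z`, the acceleration law cancels `err * ω * Φ`.
Because the angular velocity is `err + ω`, only `ω ^ 2 * Φ` survives, which sums to zero. -/
theorem dHR_field_le (hP : P.IsAdmissible) (hw : w ∈ P.Ω) :
    P.dHR w (P.field w) ≤ -P.dissipation w := by
  have key : P.dHR w (P.field w) = -P.dissipation w + ∑ i, P.err w i * (P.ω * P.G w i)
      + ∑ i, Real.sin (w.s i) * P.M w i + P.ω ^ 2 * ∑ i, P.Φ w i := by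
    simp only [dHR, dissipation, Finset.mul_sum, ← Finset.sum_neg_distrib,
      ← Finset.sum_add_distrib]
    refine Finset.sum_congr rfl fun i _ ↦ ?_
    have hq := (hP.q_pos hw i).ne'
    have hγ := (hP.γ_pos hw i).ne'
    have hv := (hw.2.2.1 i).1.ne'
    have hσ := (hP.σ_pos i).ne'
    have hr := (hP.r_pos hw i).ne'
    have e1 : P.q (w.r i) (w.s i) (w.v i) * P.F w i
        = -(P.f₁ (P.err w i) + P.ω * (P.Φ w i - P.G w i)) := by
      rw [F, err]
      field_simp
    have e2 : P.γ (w.r i) (w.s i) (w.v i) * (P.field w).s i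
        = -(P.f₂ (Real.sin (w.s i))
          + (P.ζ (w.s i) (w.v i) * P.F w i + P.Z w i) * w.v i - P.M w i) := by
      simp only [field, bicycle, State.s, δ, Real.tan_arctan]
      simp only [← State.s.eq_def]
      field_simp
      ring
    have e3 : (P.field w).v i = P.F w i := rfl
    have e4 : (P.field w).r i = -w.v i * Real.sin (w.s i) := rfl
    have e5 : (P.field w).φ i = P.err w i + P.ω := by
      simp [field, bicycle, State.φ, err]
    rw [mul_assoc (Real.sin (w.s i)), e2, e3, e4, e5]
    linear_combination P.err w i * e1
  rw [key, hP.sum_Φ hw]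
  linarith [hP.sum_err_mul_G hw, hP.sum_sin_mul_M hw]

end IsAdmissible

end RingRoad

/-! ### Sublevel sets of `HR` -/

namespace RingRoad

variable {n : ℕ} {P : RingRoad n} {w : State n}

/-- The sublevel sets of the Lyapunov function. -/
def sublevel (P : RingRoad n) (c : ℝ) : Set (State n) := {w | w ∈ P.Ω ∧ P.HR w ≤ c}

namespace IsAdmissible

theorem kinetic_nonneg (hP : P.IsAdmissible) (hw : w ∈ P.Ω) (i : Fin n) :
    0 ≤ ((w.v i / w.r i * Real.cos (w.s i) - P.ω) ^ 2
        + P.b * w.v i ^ 2 * Real.sin (w.s i) ^ 2) / ((P.vmax - w.v i) * w.v i) := by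
  obtain ⟨hv, hv'⟩ := hw.2.2.1 i
  have h2 : 0 < P.vmax - w.v i := by linarith
  have hb : 0 < P.b := lt_trans (one_div_pos.2 (pow_pos hP.Rin_pos 2)) hP.b_gt
  positivity

theorem barrier_nonneg (hP : P.IsAdmissible) (hw : w ∈ P.Ω) (i : Fin n) :
    0 ≤ 1 / (Real.cos (w.s i) - Real.cos P.Θ) - 1 / (1 - Real.cos P.Θ) :=
  sub_nonneg.2 (one_div_le_one_div_of_le (hP.cos_s_sub_pos hw i)
    (sub_le_sub_right (Real.cos_le_one _) _))

theorem potential_nonneg (hP : P.IsAdmissible) (hw : w ∈ P.Ω) {i j : Fin n}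
    (hj : j ∈ Finset.univ.erase i) : 0 ≤ P.V i j (P.dist w i j) :=
  hP.V_nonneg i j (Finset.ne_of_mem_erase hj).symm _ (hw.2.2.2 i j (Finset.ne_of_mem_erase hj))

theorem HR_nonneg (hP : P.IsAdmissible) (hw : w ∈ P.Ω) : 0 ≤ P.HR w := by
  have hA := hP.A_pos
  have h1 := Finset.sum_nonneg fun i (_ : i ∈ Finset.univ) ↦ hP.kinetic_nonneg hw i
  have h2 := Finset.sum_nonneg fun i (_ : i ∈ Finset.univ) ↦ hP.barrier_nonneg hw i
  have h3 := Finset.sum_nonneg fun i (_ : i ∈ Finset.univ) ↦ hP.U_nonneg i _ (hw.1 i)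
  have h4 := Finset.sum_nonneg fun i (_ : i ∈ Finset.univ) ↦
    Finset.sum_nonneg fun j hj ↦ hP.potential_nonneg hw (i := i) (j := j) hj
  unfold HR
  positivity

theorem terms_le_HR (hP : P.IsAdmissible) (hw : w ∈ P.Ω) :
    (∀ i, ((w.v i / w.r i * Real.cos (w.s i) - P.ω) ^ 2
        + P.b * w.v i ^ 2 * Real.sin (w.s i) ^ 2) / ((P.vmax - w.v i) * w.v i) ≤ 2 * P.HR w) ∧
    (∀ i, P.U i (w.r i) ≤ P.HR w) ∧
    (∀ i j, j ≠ i → P.V i j (P.dist w i j) ≤ 2 * P.HR w) ∧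
    ∀ i, P.A * (1 / (Real.cos (w.s i) - Real.cos P.Θ) - 1 / (1 - Real.cos P.Θ)) ≤ P.HR w := by
  have h1 := Finset.sum_nonneg fun i (_ : i ∈ Finset.univ) ↦ hP.kinetic_nonneg hw i
  have h2 := mul_nonneg hP.A_pos.le
    (Finset.sum_nonneg fun i (_ : i ∈ Finset.univ) ↦ hP.barrier_nonneg hw i)
  have h3 := Finset.sum_nonneg fun i (_ : i ∈ Finset.univ) ↦ hP.U_nonneg i _ (hw.1 i)
  have h4' := fun i ↦ Finset.sum_nonneg fun j hj ↦ hP.potential_nonneg hw (i := i) (j := j) hj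
  have h4 := Finset.sum_nonneg fun i (_ : i ∈ Finset.univ) ↦ h4' i
  refine ⟨fun i ↦ ?_, fun i ↦ ?_, fun i j hij ↦ ?_, fun i ↦ ?_⟩
  · have := Finset.single_le_sum (fun i _ ↦ hP.kinetic_nonneg hw i) (Finset.mem_univ i)
    unfold HR
    linarith
  · have := Finset.single_le_sum (f := fun i ↦ P.U i (w.r i)) (fun i _ ↦ hP.U_nonneg i _ (hw.1 i))
      (Finset.mem_univ i)
    unfold HR
    linarith
  · have e1 := Finset.single_le_sum (fun i _ ↦ h4' i) (Finset.mem_univ i)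
    have e2 := Finset.single_le_sum (f := fun j ↦ P.V i j (P.dist w i j))
      (fun j hj ↦ hP.potential_nonneg hw hj)
      (Finset.mem_erase.2 ⟨hij, Finset.mem_univ j⟩)
    unfold HR
    linarith
  · have := mul_le_mul_of_nonneg_left
      (Finset.single_le_sum (fun i _ ↦ hP.barrier_nonneg hw i) (Finset.mem_univ i)) hP.A_pos.le
    unfold HR
    linarith

/-- Sublevel sets of `HR` stay away from the boundary of `Ω`. -/
theorem exists_isClosed_superset_sublevel (hP : P.IsAdmissible) (c : ℝ) :
    ∃ D : Set (State n), IsClosed D ∧ D ⊆ P.Ω ∧ P.sublevel c ⊆ D := by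
  have ha : ∀ i, ∃ a, P.Rin < a ∧ ∀ x ∈ Ioo P.Rin a, c < P.U i x := fun i ↦ by
    obtain ⟨a, ha, h⟩ := mem_nhdsGT_iff_exists_Ioo_subset.1
      ((hP.U_tendsto_Rin i).eventually_gt_atTop c)
    exact ⟨a, ha, fun x hx ↦ h hx⟩
  have hb : ∀ i, ∃ b, b < P.Rout ∧ ∀ x ∈ Ioo b P.Rout, c < P.U i x := fun i ↦ by
    obtain ⟨b, hb, h⟩ := mem_nhdsLT_iff_exists_Ioo_subset.1
      ((hP.U_tendsto_Rout i).eventually_gt_atTop c)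
    exact ⟨b, hb, fun x hx ↦ h hx⟩
  have hl : ∀ i j, ∃ l, j ≠ i → P.L i j < l ∧ ∀ x ∈ Ioo (P.L i j) l, 2 * c < P.V i j x :=
    fun i j ↦ by
      by_cases hij : j = i
      · exact ⟨0, fun h ↦ absurd hij h⟩
      · obtain ⟨l, hl, h⟩ := mem_nhdsGT_iff_exists_Ioo_subset.1
          ((hP.V_tendsto i j (Ne.symm hij)).eventually_gt_atTop (2 * c))
        exact ⟨l, fun _ ↦ ⟨hl, fun x hx ↦ h hx⟩⟩
  choose a ha ha' using ha
  choose b hb hb' using hb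
  choose l hl using hl
  set B := c / P.A + 1 / (1 - Real.cos P.Θ)
  -- The bounds on single terms of `HR` are written with denominators cleared, so that they define
  -- closed sets in the whole space and exclude boundary values of `s` and `v`.
  refine ⟨(⋂ i, {w | w.r i ∈ Icc (a i) (b i)}) ∩ ((⋂ i, {w | w.s i ∈ Icc (-P.Θ) P.Θ}) ∩
    ((⋂ i, {w | w.v i ∈ Icc 0 P.vmax}) ∩
    ((⋂ i, {w | 1 ≤ B * (Real.cos (w.s i) - Real.cos P.Θ)}) ∩
    ((⋂ i, {w | (w.v i * Real.cos (w.s i) - w.r i * P.ω) ^ 2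
        ≤ 2 * c * ((P.vmax - w.v i) * w.v i) * w.r i ^ 2}) ∩
    (⋂ i, ⋂ j, ⋂ _ : j ≠ i, {w | l i j ≤ P.dist w i j}))))), ?_, ?_, ?_⟩
  · refine (isClosed_iInter fun i ↦ isClosed_Icc.preimage (by fun_prop)).inter <|
      (isClosed_iInter fun i ↦ isClosed_Icc.preimage (by fun_prop)).inter <|
      (isClosed_iInter fun i ↦ isClosed_Icc.preimage (by fun_prop)).inter <|
      (isClosed_iInter fun i ↦ isClosed_le (by fun_prop) (by fun_prop)).inter <|
      (isClosed_iInter fun i ↦ isClosed_le (by fun_prop) (by fun_prop)).inter <|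
      isClosed_iInter fun i ↦ isClosed_iInter fun j ↦ isClosed_iInter fun _ ↦
        isClosed_le continuous_const (P.continuous_dist i j)
  · intro w hw
    simp only [mem_inter_iff, mem_iInter, mem_ofPred_eq] at hw
    obtain ⟨h1, h2, h3, h4, h5, h6⟩ := hw
    have hr : ∀ i, w.r i ∈ Ioo P.Rin P.Rout := fun i ↦
      ⟨(ha i).trans_le (h1 i).1, (h1 i).2.trans_lt (hb i)⟩
    refine ⟨hr, fun i ↦ ?_, fun i ↦ ?_, fun i j hij ↦ (hl i j hij).1.trans_le (h6 i j hij)⟩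
    · refine ⟨lt_of_le_of_ne (h2 i).1 fun h ↦ ?_, lt_of_le_of_ne (h2 i).2 fun h ↦ ?_⟩
      · have := h4 i
        rw [← h, Real.cos_neg, sub_self, mul_zero] at this
        linarith
      · have := h4 i
        rw [h, sub_self, mul_zero] at this
        linarith
    · have hri : 0 < w.r i := hP.Rin_pos.trans (hr i).1
      have hω := hP.ω_pos
      -- At `v = 0` or `v = vmax` the right-hand side of `h5` vanishes but its left-hand side does
      -- not: it is `(r * ω) ^ 2`, respectively `(vmax * cos s - r * ω) ^ 2`.
      refine ⟨lt_of_le_of_ne (h3 i).1 fun h ↦ ?_, lt_of_le_of_ne (h3 i).2 fun h ↦ ?_⟩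
      · have := h5 i
        rw [← h] at this
        have : 0 < (w.r i * P.ω) ^ 2 := by positivity
        linarith
      · have h7 := h5 i
        rw [h] at h7
        have h8 : w.r i * P.ω < P.vmax * Real.cos (w.s i) := by
          have := hP.cos_Θ_le_cos (abs_le.2 (h2 i))
          nlinarith [hP.Rout_mul_ω_lt, hP.vmax_pos, (hr i).2]
        have : 0 < (P.vmax * Real.cos (w.s i) - w.r i * P.ω) ^ 2 := pow_pos (sub_pos.2 h8) 2
        linarith
  · rintro w ⟨hw, hc⟩
    obtain ⟨t1, t2, t3, t4⟩ := hP.terms_le_HR hw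
    simp only [mem_inter_iff, mem_iInter, mem_ofPred_eq]
    refine ⟨fun i ↦ ⟨?_, ?_⟩, fun i ↦ Ioo_subset_Icc_self (hw.2.1 i),
      fun i ↦ Ioo_subset_Icc_self (hw.2.2.1 i), fun i ↦ ?_, fun i ↦ ?_, fun i j hij ↦ ?_⟩
    · by_contra! h
      linarith [ha' i _ ⟨(hw.1 i).1, h⟩, t2 i]
    · by_contra! h
      linarith [hb' i _ ⟨h, (hw.1 i).2⟩, t2 i]
    · have hx := hP.cos_s_sub_pos hw i
      have h5 := (t4 i).trans hc
      rw [← le_div_iff₀' hP.A_pos, sub_le_iff_le_add, div_le_iff₀ hx] at h5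
      exact h5
    · have hri := hP.r_pos hw i
      obtain ⟨hv, hv'⟩ := hw.2.2.1 i
      have h2 : 0 < P.vmax - w.v i := by linarith
      have h5 := (t1 i).trans (mul_le_mul_of_nonneg_left hc zero_le_two)
      rw [div_le_iff₀ (by positivity)] at h5
      have hb0 : 0 < P.b := lt_trans (one_div_pos.2 (pow_pos hP.Rin_pos 2)) hP.b_gt
      have h6 : 0 ≤ P.b * w.v i ^ 2 * Real.sin (w.s i) ^ 2 := by positivity
      have h7 : (w.v i * Real.cos (w.s i) - w.r i * P.ω) ^ 2
          = (w.v i / w.r i * Real.cos (w.s i) - P.ω) ^ 2 * w.r i ^ 2 := by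
        field_simp
      rw [h7]
      exact mul_le_mul_of_nonneg_right (by linarith) (by positivity)
    · by_contra! h
      linarith [(hl i j hij).2 _ ⟨hw.2.2.2 i j hij, h⟩, t3 i j hij]

/-- `Ω` is open and `HR` is controlled only on it, so closedness in the whole space needs the closed
set `D ⊆ Ω` around the sublevel set. -/
theorem isClosed_sublevel (hP : P.IsAdmissible) (c : ℝ) : IsClosed (P.sublevel c) := by
  obtain ⟨D, hD, hDΩ, hcD⟩ := hP.exists_isClosed_superset_sublevel c
  have : P.sublevel c = D ∩ P.HR ⁻¹' Iic c := by
    ext w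
    exact ⟨fun h ↦ ⟨hcD h, h.2⟩, fun h ↦ ⟨hDΩ h.1, h.2⟩⟩
  rw [this]
  exact (hP.contDiffOn_HR.continuousOn.mono hDΩ).preimage_isClosed_of_isClosed hD isClosed_Iic

end IsAdmissible

/-! ### Periodicity in the angles and compactness modulo full turns -/

/-- The translation that adds `2π k i` to the angular coordinate of vehicle `i`. -/
def turn (k : Fin n → ℤ) : State n := (0, fun i ↦ k i * (2 * Real.pi), 0, 0)

section Periodicity

variable (w) (k : Fin n → ℤ) (i j : Fin n)

@[simp] theorem add_turn_r : (w + turn k).r = w.r := by simp [State.r, turn]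

@[simp] theorem add_turn_s : (w + turn k).s = w.s := by simp [State.s, turn]

@[simp] theorem add_turn_v : (w + turn k).v = w.v := by simp [State.v, turn]

theorem add_turn_φ : (w + turn k).φ i = w.φ i + k i * (2 * Real.pi) := by simp [State.φ, turn]

theorem add_turn_φ_sub :
    (w + turn k).φ i - (w + turn k).φ j = w.φ i - w.φ j + (k i - k j : ℤ) * (2 * Real.pi) := by
  rw [add_turn_φ, add_turn_φ]
  push_cast
  ring

@[simp] theorem cos_add_turn_φ_sub :
    Real.cos ((w + turn k).φ i - (w + turn k).φ j) = Real.cos (w.φ i - w.φ j) := by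
  rw [add_turn_φ_sub, Real.cos_add_int_mul_two_pi]

@[simp] theorem sin_add_turn_φ_sub :
    Real.sin ((w + turn k).φ i - (w + turn k).φ j) = Real.sin (w.φ i - w.φ j) := by
  rw [add_turn_φ_sub, Real.sin_add_int_mul_two_pi]

@[simp] theorem dist_add_turn : P.dist (w + turn k) i j = P.dist w i j := by simp [dist]

@[simp] theorem HR_add_turn : P.HR (w + turn k) = P.HR w := by simp [HR]

@[simp] theorem add_turn_mem_Ω : w + turn k ∈ P.Ω ↔ w ∈ P.Ω := by simp [Ω]

@[simp] theorem add_turn_mem_sublevel (c : ℝ) :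
    w + turn k ∈ P.sublevel c ↔ w ∈ P.sublevel c := by simp [sublevel]

@[simp] theorem F_add_turn : P.F (w + turn k) = P.F w := by
  ext i; simp [F, Φ, G]

@[simp] theorem δ_add_turn : P.δ (w + turn k) = P.δ w := by
  ext i; simp [δ, Z, M]

@[simp] theorem field_add_turn : P.field (w + turn k) = P.field w := by
  simp [field, bicycle]

@[simp] theorem dissipation_add_turn : P.dissipation (w + turn k) = P.dissipation w := by
  simp [dissipation, err]

end Periodicity

theorem exists_turn (w : State n) :
    ∃ k : Fin n → ℤ, ∀ i, (w + turn k).φ i ∈ Icc 0 (2 * Real.pi) := by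
  refine ⟨fun i ↦ -toIcoDiv Real.two_pi_pos 0 (w.φ i), fun i ↦ ?_⟩
  have := sub_toIcoDiv_zsmul_mem_Ico Real.two_pi_pos 0 (w.φ i)
  rw [zero_add, zsmul_eq_mul] at this
  rw [add_turn_φ]
  push_cast
  rw [neg_mul, ← sub_eq_add_neg]
  exact Ico_subset_Icc_self this

namespace IsAdmissible

/-- A continuous function that is periodic in the angles is bounded on sublevel sets of `HR`. -/
theorem exists_bound_on_sublevel (hP : P.IsAdmissible) {E : Type*} [NormedAddCommGroup E]
    {g : State n → E} (hg : ContinuousOn g P.Ω) (hper : ∀ w k, g (w + turn k) = g w) (c : ℝ) :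
    ∃ C : NNReal, ∀ w ∈ P.sublevel c, ‖g w‖ ≤ C := by
  -- Only the angles are unbounded on a sublevel set. Turning each into `[0, 2π]` brings every point
  -- into this compact piece.
  have hK : IsCompact (P.sublevel c ∩ Icc
      ((fun _ ↦ P.Rin, fun _ ↦ 0, fun _ ↦ -P.Θ, fun _ ↦ 0) : State n)
      (fun _ ↦ P.Rout, fun _ ↦ 2 * Real.pi, fun _ ↦ P.Θ, fun _ ↦ P.vmax)) :=
    isCompact_Icc.inter_left (hP.isClosed_sublevel c)
  obtain ⟨C, hC⟩ := hK.exists_bound_of_continuousOn (hg.mono fun w hw ↦ hw.1.1)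
  refine ⟨C.toNNReal, fun w hw ↦ ?_⟩
  obtain ⟨k, hk⟩ := exists_turn w
  have hw' := (add_turn_mem_sublevel w k c).2 hw
  rw [← hper w k]
  refine (hC _ ⟨hw', ?_, ?_⟩).trans (Real.le_coe_toNNReal C)
  · exact ⟨fun i ↦ (hw'.1.1 i).1.le, fun i ↦ (hk i).1, fun i ↦ (hw'.1.2.1 i).1.le,
      fun i ↦ (hw'.1.2.2.1 i).1.le⟩
  · exact ⟨fun i ↦ (hw'.1.1 i).2.le, fun i ↦ (hk i).2, fun i ↦ (hw'.1.2.1 i).2.le,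
      fun i ↦ (hw'.1.2.2.1 i).2.le⟩

end IsAdmissible

/-! ### Truncation to globally Lipschitz functions -/

/-- The function `g`, cut off smoothly between the levels `c + 1` and `c + 2` of `HR`. -/
def cutoff {E : Type*} [NormedAddCommGroup E] [NormedSpace ℝ E] (P : RingRoad n) (c : ℝ)
    (g : State n → E) (w : State n) : E :=
  P.Ω.indicator (fun w ↦ Real.smoothTransition (c + 2 - P.HR w) • g w) w

section Cutoff

variable {E : Type*} [NormedAddCommGroup E] [NormedSpace ℝ E] {g : State n → E} {c : ℝ}

theorem cutoff_of_mem (hw : w ∈ P.Ω) :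
    P.cutoff c g w = Real.smoothTransition (c + 2 - P.HR w) • g w :=
  indicator_of_mem hw _

theorem cutoff_of_mem_sublevel (hw : w ∈ P.sublevel c) : P.cutoff c g w = g w := by
  rw [cutoff_of_mem hw.1, Real.smoothTransition.one_of_one_le (by linarith [hw.2]), one_smul]

theorem cutoff_of_notMem_sublevel (hw : w ∉ P.sublevel (c + 2)) : P.cutoff c g w = 0 := by
  by_cases h : w ∈ P.Ω
  · have : c + 2 < P.HR w := by
      by_contra! h'
      exact hw ⟨h, h'⟩
    rw [cutoff_of_mem h, Real.smoothTransition.zero_of_nonpos (by linarith), zero_smul]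
  · exact indicator_of_notMem h _

theorem cutoff_add_turn (hper : ∀ w k, g (w + turn k) = g w) (k : Fin n → ℤ) :
    P.cutoff c g (w + turn k) = P.cutoff c g w := by
  by_cases hw : w ∈ P.Ω
  · rw [cutoff_of_mem hw, cutoff_of_mem ((add_turn_mem_Ω w k).2 hw), hper, HR_add_turn]
  · rw [cutoff_of_notMem_sublevel fun h ↦ hw h.1,
      cutoff_of_notMem_sublevel fun h ↦ hw ((add_turn_mem_Ω w k).1 h.1)]

namespace IsAdmissible

/-- Since the sublevel set is closed in the whole space, this also covers points outside `Ω`; it is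
what glues the truncation to a `C^1` function. -/
theorem cutoff_eventuallyEq_zero (hP : P.IsAdmissible) (hw : w ∉ P.sublevel (c + 2)) :
    P.cutoff c g =ᶠ[𝓝 w] fun _ ↦ 0 := by
  filter_upwards [(hP.isClosed_sublevel (c + 2)).isOpen_compl.mem_nhds hw] with w' hw'
    using cutoff_of_notMem_sublevel hw'

theorem contDiff_cutoff (hP : P.IsAdmissible) (hg : ContDiffOn ℝ 1 g P.Ω) :
    ContDiff ℝ 1 (P.cutoff c g) := by
  rw [contDiff_iff_contDiffAt]
  intro w
  by_cases hw : w ∈ P.Ω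
  · have hΩ := P.isOpen_Ω.mem_nhds hw
    have h : ContDiffAt ℝ 1 (fun w ↦ Real.smoothTransition (c + 2 - P.HR w) • g w) w :=
      (Real.smoothTransition.contDiffAt.comp w
        (contDiffAt_const.sub (hP.contDiffOn_HR.contDiffAt hΩ))).smul (hg.contDiffAt hΩ)
    refine h.congr_of_eventuallyEq ?_
    filter_upwards [hΩ] with w' hw' using cutoff_of_mem hw'
  · exact contDiffAt_const.congr_of_eventuallyEq
      (hP.cutoff_eventuallyEq_zero fun h ↦ hw h.1)

/-- The derivative inherits periodicity and vanishes off a sublevel set, so compactness modulo turns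
bounds it globally. -/
theorem exists_lipschitzWith_cutoff (hP : P.IsAdmissible) (hg : ContDiffOn ℝ 1 g P.Ω)
    (hper : ∀ w k, g (w + turn k) = g w) : ∃ K : NNReal, LipschitzWith K (P.cutoff c g) := by
  have hc := hP.contDiff_cutoff (c := c) hg
  obtain ⟨K, hK⟩ := hP.exists_bound_on_sublevel (g := fderiv ℝ (P.cutoff c g))
    (hc.continuous_fderiv (by norm_num)).continuousOn (fun w k ↦ by
      rw [← fderiv_comp_add_right]
      simp only [cutoff_add_turn hper]) (c + 2)
  refine ⟨K, lipschitzWith_of_nnnorm_fderiv_le (hc.differentiable (by norm_num)) fun w ↦ ?_⟩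
  by_cases hw : w ∈ P.sublevel (c + 2)
  · exact hK w hw
  · rw [(hP.cutoff_eventuallyEq_zero hw).fderiv_eq]
    simp

theorem exists_bound_cutoff (hP : P.IsAdmissible) (hg : ContDiffOn ℝ 1 g P.Ω)
    (hper : ∀ w k, g (w + turn k) = g w) : ∃ C : NNReal, ∀ w, ‖P.cutoff c g w‖ ≤ C := by
  obtain ⟨C, hC⟩ := hP.exists_bound_on_sublevel (g := P.cutoff c g)
    (hP.contDiff_cutoff hg).continuous.continuousOn (fun w k ↦ cutoff_add_turn hper k) (c + 2)
  refine ⟨C, fun w ↦ ?_⟩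
  by_cases hw : w ∈ P.sublevel (c + 2)
  · exact hC w hw
  · rw [cutoff_of_notMem_sublevel hw]
    simp

end IsAdmissible

end Cutoff

end RingRoad

/-! ### From vanishing dissipation to vanishing errors -/

/-- If `h` is continuous and positive off `0`, and `h ∘ x → 0` with `x` bounded, then `x → 0`. -/
theorem tendsto_zero_of_comp_tendsto_zero {h x : ℝ → ℝ} {B : ℝ} (hh : Continuous h)
    (hpos : ∀ y, y ≠ 0 → 0 < h y) (hB : ∀ t, 0 ≤ t → |x t| ≤ B)
    (hx : Tendsto (fun t ↦ h (x t)) atTop (𝓝 0)) : Tendsto x atTop (𝓝 0) := by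
  rw [Metric.tendsto_nhds]
  intro ε hε
  have hK : IsCompact (Icc (-B) B ∩ {y | ε ≤ |y|}) :=
    isCompact_Icc.inter_right (isClosed_le continuous_const continuous_abs)
  -- `m` is the minimum of `h` over the compact set of `y` with `ε ≤ |y| ≤ B`; any positive value
  -- serves if that set is empty.
  obtain ⟨m, hm, hmK⟩ : ∃ m, 0 < m ∧ ∀ y ∈ Icc (-B) B ∩ {y | ε ≤ |y|}, m ≤ h y := by
    rcases (Icc (-B) B ∩ {y | ε ≤ |y|}).eq_empty_or_nonempty with he | hne
    · exact ⟨1, one_pos, fun y hy ↦ by simp [he] at hy⟩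
    · obtain ⟨y, hy, hmin⟩ := hK.exists_isMinOn hne hh.continuousOn
      exact ⟨h y, hpos y (abs_pos.1 (hε.trans_le hy.2)), fun z hz ↦ hmin hz⟩
  filter_upwards [hx.eventually_lt_const hm, eventually_ge_atTop 0] with t ht ht0
  rw [Real.dist_eq, sub_zero]
  by_contra! hge
  exact absurd (hmK (x t) ⟨abs_le.1 (hB t ht0), hge⟩) (not_le.2 ht)

namespace State

variable {n : ℕ}

theorem lipschitzWith_r (i : Fin n) : LipschitzWith 1 (fun w : State n ↦ w.r i) :=
  LipschitzWith.of_dist_le_mul fun x y ↦ by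
    rw [NNReal.coe_one, one_mul]
    exact (dist_le_pi_dist x.1 y.1 i).trans (le_max_left _ _)

theorem lipschitzWith_s (i : Fin n) : LipschitzWith 1 (fun w : State n ↦ w.s i) :=
  LipschitzWith.of_dist_le_mul fun x y ↦ by
    rw [NNReal.coe_one, one_mul]
    exact (dist_le_pi_dist x.2.2.1 y.2.2.1 i).trans <| (le_max_left _ _).trans <|
      (le_max_right _ _).trans (le_max_right _ _)

theorem lipschitzWith_v (i : Fin n) : LipschitzWith 1 (fun w : State n ↦ w.v i) :=
  LipschitzWith.of_dist_le_mul fun x y ↦ by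
    rw [NNReal.coe_one, one_mul]
    exact (dist_le_pi_dist x.2.2.2 y.2.2.2 i).trans <| (le_max_right _ _).trans <|
      (le_max_right _ _).trans (le_max_right _ _)

end State

/-! ### Invariance, convergence, uniqueness -/

namespace RingRoad

variable {n : ℕ} {P : RingRoad n}

namespace IsAdmissible

/-- The factor `a` serves both the true field (`a = 1`) and the truncated one: slowing the motion
down does not change the sign of the derivative of `HR`. -/
theorem antitoneOn_HR (hP : P.IsAdmissible) {w : ℝ → State n} {a : ℝ → ℝ} {J : Set ℝ}
    (hJ : Convex ℝ J) (hw : ∀ t ∈ J, w t ∈ P.Ω) (ha : ∀ t ∈ J, 0 ≤ a t)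
    (hd : ∀ t ∈ J, HasDerivWithinAt w (a t • P.field (w t)) J t) :
    AntitoneOn (fun t ↦ P.HR (w t)) J := by
  have h := fun t ht ↦ hP.hasDerivWithinAt_HR (hd t ht) (hw t ht)
  refine antitoneOn_of_hasDerivWithinAt_nonpos hJ (fun t ht ↦ (h t ht).continuousWithinAt)
    (fun t ht ↦ (h t (interior_subset ht)).mono interior_subset) fun t ht ↦ ?_
  have ht' := interior_subset ht
  rw [dHR_smul]
  exact mul_nonpos_of_nonneg_of_nonpos (ha t ht') <| (hP.dHR_field_le (hw t ht')).trans <|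
    neg_nonpos.2 (hP.dissipation_nonneg _)

theorem mem_sublevel_of_isSolutionOn (hP : P.IsAdmissible) {w₀ : State n} {J : Set ℝ}
    (hJ : J.OrdConnected) (h0 : 0 ∈ J) {y : ℝ → State n} (hy : P.IsSolutionOn w₀ J y) {t : ℝ}
    (ht : t ∈ J) (ht0 : 0 ≤ t) : y t ∈ P.sublevel (P.HR w₀) := by
  have hanti := hP.antitoneOn_HR (a := fun _ ↦ 1) hJ.convex hy.mem (fun _ _ ↦ zero_le_one)
    fun t ht ↦ by rw [one_smul]; exact hy.deriv t ht
  exact ⟨hy.mem t ht, by simpa only [hy.1] using hanti h0 ht ht0⟩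

/-- An integral curve of the truncated field that starts in a sublevel set stays there. -/
theorem mem_sublevel_of_integralCurve (hP : P.IsAdmissible) {c : ℝ} {w : ℝ → State n}
    (h0 : w 0 ∈ P.sublevel c) (hd : ∀ t, HasDerivAt w (P.cutoff c P.field (w t)) t) {t : ℝ}
    (ht : 0 ≤ t) : w t ∈ P.sublevel c := by
  have hcont : Continuous w := continuous_iff_continuousAt.2 fun t ↦ (hd t).continuousAt
  have hcl : IsClosed {t | w t ∈ P.sublevel c} := (hP.isClosed_sublevel c).preimage hcont
  -- Continuous induction in time. The set of good times is closed; from a good time the curve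
  -- remains in the open set `Ω` for a while, and there `HR` cannot increase.
  refine (hcl.inter isClosed_Icc).Icc_subset_of_forall_mem_nhdsWithin (a := 0) (b := t) h0
    (fun τ hτ ↦ ?_) ⟨ht, le_rfl⟩
  obtain ⟨ε, hε, hsub⟩ := mem_nhdsGE_iff_exists_Icc_subset.1 (mem_nhdsWithin_of_mem_nhds
    ((P.isOpen_Ω.preimage hcont).mem_nhds hτ.1.1))
  have hanti := hP.antitoneOn_HR (w := w) (J := Icc τ ε)
    (a := fun t ↦ Real.smoothTransition (c + 2 - P.HR (w t))) (convex_Icc _ _)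
    (fun t ht ↦ hsub ht) (fun t _ ↦ Real.smoothTransition.nonneg _) fun t ht ↦ by
      rw [← cutoff_of_mem (hsub ht)]
      exact (hd t).hasDerivWithinAt
  filter_upwards [Icc_mem_nhdsGT hε] with u hu
  exact ⟨hsub hu, (hanti ⟨le_rfl, hε.le⟩ hu hu.1).trans hτ.1.2⟩

theorem contDiffOn_dissipation (hP : P.IsAdmissible) : ContDiffOn ℝ 1 P.dissipation P.Ω := by
  unfold dissipation
  refine ContDiffOn.sum fun i _ ↦ ContDiffOn.add ((hP.contDiffOn_err i).mul
    (hP.f₁_contDiff.comp_contDiffOn (hP.contDiffOn_err i))) (ContDiffOn.mul (by fun_prop)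
    (hP.f₂_contDiff.comp_contDiffOn (by fun_prop)))

/-- The friction terms force the angular speed errors and the orientations to vanish. -/
theorem tendsto_err_and_sin (hP : P.IsAdmissible) {c : ℝ} {w : ℝ → State n}
    (hw : ∀ t, 0 ≤ t → w t ∈ P.sublevel c)
    (hW : Tendsto (fun t ↦ P.dissipation (w t)) atTop (𝓝 0)) (i : Fin n) :
    Tendsto (fun t ↦ P.err (w t) i) atTop (𝓝 0) ∧
    Tendsto (fun t ↦ Real.sin ((w t).s i)) atTop (𝓝 0) := by
  have hle : ∀ w : State n, P.err w i * P.f₁ (P.err w i)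
      + Real.sin (w.s i) * P.f₂ (Real.sin (w.s i)) ≤ P.dissipation w := fun w ↦
    Finset.single_le_sum (f := fun i ↦ P.err w i * P.f₁ (P.err w i)
      + Real.sin (w.s i) * P.f₂ (Real.sin (w.s i))) (fun j _ ↦ add_nonneg
      (hP.dissipation_term_nonneg w j).1 (hP.dissipation_term_nonneg w j).2) (Finset.mem_univ i)
  have hnn := fun t ↦ hP.dissipation_term_nonneg (w t) i
  obtain ⟨B, hB⟩ := hP.exists_bound_on_sublevel (hP.contDiffOn_err i).continuousOn
    (fun w k ↦ by simp [err]) c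
  constructor
  · refine tendsto_zero_of_comp_tendsto_zero (h := fun x ↦ x * P.f₁ x)
      (continuous_id.mul hP.f₁_contDiff.continuous) hP.f₁_sign (fun t ht ↦ hB _ (hw t ht)) ?_
    exact squeeze_zero (fun t ↦ (hnn t).1) (fun t ↦ by linarith [hle (w t), (hnn t).2]) hW
  · refine tendsto_zero_of_comp_tendsto_zero (h := fun x ↦ x * P.f₂ x)
      (continuous_id.mul hP.f₂_contDiff.continuous) hP.f₂_sign
      (fun t _ ↦ Real.abs_sin_le_one _) ?_
    exact squeeze_zero (fun t ↦ (hnn t).2) (fun t ↦ by linarith [hle (w t), (hnn t).1]) hW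

theorem tendsto_of_integralCurve (hP : P.IsAdmissible) {c : ℝ} {w : ℝ → State n}
    (hw : ∀ t, 0 ≤ t → w t ∈ P.sublevel c)
    (hd : ∀ t, HasDerivAt w (P.cutoff c P.field (w t)) t) (i : Fin n) :
    Tendsto (fun t ↦ (w t).s i) atTop (𝓝 0) ∧
    Tendsto (fun t ↦ (w t).v i / (w t).r i) atTop (𝓝 P.ω) ∧
    Tendsto (fun t ↦ deriv (fun τ ↦ (w τ).s i) t) atTop (𝓝 0) ∧
    Tendsto (fun t ↦ P.F (w t) i) atTop (𝓝 0) := by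
  obtain ⟨C, hC⟩ := hP.exists_bound_cutoff (c := c) hP.contDiffOn_field field_add_turn
  obtain ⟨K, hK⟩ := hP.exists_lipschitzWith_cutoff (c := c) hP.contDiffOn_field field_add_turn
  obtain ⟨K', hK'⟩ := hP.exists_lipschitzWith_cutoff (c := c) hP.contDiffOn_dissipation
    dissipation_add_turn
  have hwL : LipschitzWith C w := lipschitzWith_of_nnnorm_deriv_le
    (fun t ↦ (hd t).differentiableAt) fun t ↦ by rw [(hd t).deriv]; exact hC _
  have hfield : ∀ t, 0 ≤ t → P.cutoff c P.field (w t) = P.field (w t) := fun t ht ↦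
    cutoff_of_mem_sublevel (hw t ht)
  have hdiss : ∀ t, 0 ≤ t → P.cutoff c P.dissipation (w t) = P.dissipation (w t) := fun t ht ↦
    cutoff_of_mem_sublevel (hw t ht)
  have hW : Tendsto (fun t ↦ P.dissipation (w t)) atTop (𝓝 0) := by
    refine (tendsto_zero_of_dissipation (H := fun t ↦ P.HR (w t))
      (H' := fun t ↦ P.dHR (w t) (P.field (w t))) (hK'.comp hwL)
      (fun t ht ↦ hP.HR_nonneg (hw t ht).1) (fun t ht ↦ ?_) (fun t ht ↦ ?_)
      (fun t ht ↦ ?_)).congr' ?_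
    · have := hP.hasDerivWithinAt_HR (hd t).hasDerivWithinAt (J := univ) (hw t ht).1
      rwa [hasDerivWithinAt_univ, hfield t ht] at this
    · rw [Function.comp_apply, hdiss t ht]
      exact hP.dHR_field_le (hw t ht).1
    · rw [Function.comp_apply, hdiss t ht]
      exact hP.dissipation_nonneg _
    · filter_upwards [eventually_ge_atTop 0] with t ht using hdiss t ht
  obtain ⟨herr, hsin⟩ := hP.tendsto_err_and_sin hw hW i
  -- Since `Θ < π / 2`, `arcsin` inverts `sin` along the trajectory.
  have hs : Tendsto (fun t ↦ (w t).s i) atTop (𝓝 0) := by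
    have h := (Real.continuous_arcsin.tendsto 0).comp hsin
    rw [Real.arcsin_zero] at h
    refine h.congr' ?_
    filter_upwards [eventually_ge_atTop 0] with t ht
    have := (hw t ht).1.2.1 i
    exact Real.arcsin_sin (by linarith [this.1, hP.Θ_lt]) (by linarith [this.2, hP.Θ_lt])
  have hvr : Tendsto (fun t ↦ (w t).v i / (w t).r i) atTop (𝓝 P.ω) := by
    have hcos := (Real.continuous_cos.tendsto 0).comp hs
    rw [Real.cos_zero] at hcos
    have h := (herr.add_const P.ω).div hcos one_ne_zero
    rw [zero_add, div_one] at h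
    refine h.congr' ?_
    filter_upwards [eventually_ge_atTop 0] with t ht
    have := (hP.cos_s_pos (hw t ht).1 i).ne'
    simp only [Pi.div_apply, err, Function.comp_apply, sub_add_cancel]
    field_simp
  have hr' : ∀ t, HasDerivAt (fun τ ↦ (w τ).r i) ((P.cutoff c P.field (w t)).r i) t := fun t ↦
    hasDerivAt_pi.1 (hd t).fst i
  have hs' : ∀ t, HasDerivAt (fun τ ↦ (w τ).s i) ((P.cutoff c P.field (w t)).s i) t := fun t ↦
    hasDerivAt_pi.1 (hd t).snd.snd.fst i
  have hv' : ∀ t, HasDerivAt (fun τ ↦ (w τ).v i) ((P.cutoff c P.field (w t)).v i) t := fun t ↦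
    hasDerivAt_pi.1 (hd t).snd.snd.snd i
  refine ⟨hs, hvr, ?_, ?_⟩
  · simp only [fun t ↦ (hs' t).deriv]
    exact tendsto_deriv_zero_of_tendsto ((State.lipschitzWith_s i).comp (hK.comp hwL))
      (fun t _ ↦ hs' t) hs
  -- `r` is not known to converge, so Barbalat's lemma is applied to `v - ω * r` instead of `v`. Its
  -- derivative is `F + ω * v * sin s`, and the last term tends to zero.
  · have hvr0 : Tendsto (fun t ↦ (w t).v i - P.ω * (w t).r i) atTop (𝓝 0) := by
      have h : Tendsto (fun t ↦ P.Rout * |(w t).v i / (w t).r i - P.ω|) atTop (𝓝 0) := by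
        simpa using (hvr.sub_const P.ω).abs.const_mul P.Rout
      refine squeeze_zero_norm' ?_ h
      filter_upwards [eventually_ge_atTop 0] with t ht
      have hrp := hP.r_pos (hw t ht).1 i
      have e : (w t).v i - P.ω * (w t).r i = (w t).r i * ((w t).v i / (w t).r i - P.ω) := by
        field_simp
      rw [e, Real.norm_eq_abs, abs_mul, abs_of_pos hrp]
      exact mul_le_mul_of_nonneg_right ((hw t ht).1.1 i).2.le (abs_nonneg _)
    have hlip : LipschitzWith (1 * (K * C) + ‖P.ω‖₊ * (1 * (K * C))) fun t ↦
        (P.cutoff c P.field (w t)).v i - P.ω * (P.cutoff c P.field (w t)).r i :=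
      ((State.lipschitzWith_v i).comp (hK.comp hwL)).sub
        ((lipschitzWith_smul P.ω).comp ((State.lipschitzWith_r i).comp (hK.comp hwL)))
    have h1 := tendsto_deriv_zero_of_tendsto hlip
      (fun t _ ↦ (hv' t).sub ((hr' t).const_mul P.ω)) hvr0
    have h2 : Tendsto (fun t ↦ (w t).v i * Real.sin ((w t).s i)) atTop (𝓝 0) := by
      have h : Tendsto (fun t ↦ P.vmax * |Real.sin ((w t).s i)|) atTop (𝓝 0) := by
        simpa using hsin.abs.const_mul P.vmax
      refine squeeze_zero_norm' ?_ h
      filter_upwards [eventually_ge_atTop 0] with t ht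
      obtain ⟨hv0, hv1⟩ := (hw t ht).1.2.2.1 i
      rw [Real.norm_eq_abs, abs_mul, abs_of_pos hv0]
      exact mul_le_mul_of_nonneg_right hv1.le (abs_nonneg _)
    have h3 := h1.sub (h2.const_mul P.ω)
    rw [mul_zero, sub_zero] at h3
    refine h3.congr' ?_
    filter_upwards [eventually_ge_atTop 0] with t ht
    rw [hfield t ht]
    simp only [field, bicycle, State.r, State.s, State.v]
    ring

theorem exists_integralCurve (hP : P.IsAdmissible) {w₀ : State n} (hw₀ : w₀ ∈ P.Ω) :
    ∃ w : ℝ → State n, w 0 = w₀ ∧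
      (∀ t, HasDerivAt w (P.cutoff (P.HR w₀) P.field (w t)) t) ∧
      ∀ t, 0 ≤ t → w t ∈ P.sublevel (P.HR w₀) := by
  obtain ⟨C, hC⟩ := hP.exists_bound_cutoff (c := P.HR w₀) hP.contDiffOn_field field_add_turn
  obtain ⟨K, hK⟩ := hP.exists_lipschitzWith_cutoff (c := P.HR w₀) hP.contDiffOn_field
    field_add_turn
  obtain ⟨w, h0, hd⟩ := exists_global_integralCurve hK hC w₀
  exact ⟨w, h0, hd, fun t ht ↦
    hP.mem_sublevel_of_integralCurve (by rw [h0]; exact ⟨hw₀, le_rfl⟩) hd ht⟩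

/-- Any solution stays in the initial sublevel set by monotonicity of `HR`, hence also solves the
truncated system, where Lipschitz uniqueness applies. -/
theorem eqOn_of_isSolutionOn (hP : P.IsAdmissible) {w₀ : State n} {w : ℝ → State n}
    (h0 : w 0 = w₀) (hd : ∀ t, HasDerivAt w (P.cutoff (P.HR w₀) P.field (w t)) t)
    {J : Set ℝ} (hJ : J.OrdConnected) (hJ0 : 0 ∈ J) (hJ' : J ⊆ Ici 0) {y : ℝ → State n}
    (hy : P.IsSolutionOn w₀ J y) : EqOn y w J := by
  obtain ⟨K, hK⟩ := hP.exists_lipschitzWith_cutoff (c := P.HR w₀) hP.contDiffOn_field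
    field_add_turn
  intro t ht
  have hsub : Icc 0 t ⊆ J := hJ.out hJ0 ht
  refine ODE_solution_unique (v := fun _ ↦ P.cutoff (P.HR w₀) P.field) (K := K) (fun _ ↦ hK)
    (fun τ hτ ↦ ((hy.deriv τ (hsub hτ)).continuousWithinAt).mono hsub) (fun τ hτ ↦ ?_)
    (fun τ _ ↦ (hd τ).continuousAt.continuousWithinAt) (fun τ _ ↦ (hd τ).hasDerivWithinAt)
    (by rw [hy.1, h0]) ⟨hJ' ht, le_rfl⟩
  have hτJ := hsub (Ico_subset_Icc_self hτ)
  rw [cutoff_of_mem_sublevel (hP.mem_sublevel_of_isSolutionOn hJ hJ0 hy hτJ hτ.1)]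
  -- Only the right derivative at `τ < t` is needed, and `J` contains a right neighbourhood of `τ`.
  refine (hy.deriv τ hτJ).mono_of_mem_nhdsWithin ?_
  filter_upwards [Icc_mem_nhdsGE hτ.2] with u hu using hsub ⟨hτ.1.trans hu.1, hu.2⟩

theorem exists_input_bound (hP : P.IsAdmissible) (c : ℝ) :
    ∃ C : ℝ, ∀ w ∈ P.sublevel c, ∀ i, |P.F w i| + |P.δ w i| ≤ C := by
  obtain ⟨C₁, h₁⟩ := hP.exists_bound_on_sublevel (g := P.F)
    (continuousOn_pi.2 fun i ↦ (hP.contDiffOn_F i).continuousOn) F_add_turn c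
  obtain ⟨C₂, h₂⟩ := hP.exists_bound_on_sublevel (g := P.δ)
    (continuousOn_pi.2 fun i ↦ (hP.contDiffOn_δ i).continuousOn) δ_add_turn c
  exact ⟨C₁ + C₂, fun w hw i ↦ add_le_add ((norm_le_pi_norm (P.F w) i).trans (h₁ w hw))
    ((norm_le_pi_norm (P.δ w) i).trans (h₂ w hw))⟩

end IsAdmissible

/-! ### The uniform input bound -/

/-- The values of the inputs on the sublevel set at height `c`, together with `0`. -/
def inputValues (P : RingRoad n) (c : ℝ) : Set ℝ :=
  insert 0 {x | ∃ w ∈ P.sublevel c, ∃ i, x = |P.F w i| + |P.δ w i|}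

theorem IsAdmissible.bddAbove_inputValues (hP : P.IsAdmissible) (c : ℝ) :
    BddAbove (P.inputValues c) := by
  obtain ⟨C, hC⟩ := hP.exists_input_bound c
  refine BddAbove.insert 0 ⟨C, ?_⟩
  rintro _ ⟨w, hw, i, rfl⟩
  exact hC w hw i

theorem inputValues_mono {c c' : ℝ} (h : c ≤ c') : P.inputValues c ⊆ P.inputValues c' :=
  insert_subset_insert fun _ ⟨w, hw, i, hx⟩ ↦ ⟨w, ⟨hw.1, hw.2.trans h⟩, i, hx⟩

end RingRoad
end

theorem theorem2 (n : ℕ) (P : RingRoad n) (hP : P.IsAdmissible) :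
    (∀ w₀ ∈ P.Ω, ∃ w : ℝ → State n,
      P.IsSolutionOn w₀ (Set.Ici 0) w ∧
      (∀ t, 0 ≤ t → w t ∈ P.Ω) ∧
      (∀ J : Set ℝ, J.OrdConnected → 0 ∈ J → J ⊆ Set.Ici 0 →
        ∀ y : ℝ → State n, P.IsSolutionOn w₀ J y → Set.EqOn y w J) ∧
      ∀ i : Fin n,
        Filter.Tendsto (fun t => (w t).s i) Filter.atTop (nhds 0) ∧
        Filter.Tendsto (fun t => (w t).v i / (w t).r i) Filter.atTop (nhds P.ω) ∧
        Filter.Tendsto (fun t => deriv (fun τ => (w τ).s i) t) Filter.atTop (nhds 0) ∧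
        Filter.Tendsto (fun t => P.F (w t) i) Filter.atTop (nhds 0)) ∧
    ∃ P₂ : ℝ → ℝ, MonotoneOn P₂ (Set.Ici 0) ∧ (∀ x, 0 ≤ x → 0 ≤ P₂ x) ∧
      ∀ w₀ ∈ P.Ω, 0 ≤ P.HR w₀ ∧
        ∀ w : ℝ → State n, P.IsSolutionOn w₀ (Set.Ici 0) w →
          ∀ t, 0 ≤ t → ∀ i : Fin n, |P.F (w t) i| + |P.δ (w t) i| ≤ P₂ (P.HR w₀) := by
  refine ⟨fun w₀ hw₀ ↦ ?_, fun c ↦ sSup (P.inputValues c), ?_, ?_, fun w₀ hw₀ ↦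
    ⟨hP.HR_nonneg hw₀, fun w hw t ht i ↦ ?_⟩⟩
  · obtain ⟨w, h0, hd, hmem⟩ := hP.exists_integralCurve hw₀
    refine ⟨w, ⟨h0, fun t ht ↦ (hmem t ht).1, fun t ht ↦ ?_⟩, fun t ht ↦ (hmem t ht).1,
      fun J hJ hJ0 hJ' y hy ↦ hP.eqOn_of_isSolutionOn h0 hd hJ hJ0 hJ' hy,
      fun i ↦ hP.tendsto_of_integralCurve hmem hd i⟩
    have := (hd t).hasDerivWithinAt (s := Ici 0)
    rwa [RingRoad.cutoff_of_mem_sublevel (hmem t ht)] at this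
  -- The element `0` keeps the supremum meaningful for an empty sublevel set and makes it
  -- nonnegative.
  · exact fun c _ c' _ h ↦ csSup_le_csSup (hP.bddAbove_inputValues c') ⟨0, mem_insert _ _⟩
      (RingRoad.inputValues_mono h)
  · exact fun c _ ↦ le_csSup (hP.bddAbove_inputValues c) (mem_insert _ _)
  · exact le_csSup (hP.bddAbove_inputValues _) (mem_insert_of_mem _
      ⟨w t, hP.mem_sublevel_of_isSolutionOn ordConnected_Ici self_mem_Ici hw ht ht, i, rfl⟩)
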